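/- **Setting.** Let $X$ be a (Hausdorff, second countable) smooth $m$-dimensional manifold with a Borel measure $\mu$, and let $L$ be a diffusion on $X$, i.e. in local charts $L=\sum_{i,j}a_{ij}\partial_{ij}+\sum_i b_i\partial_i$ with $(a_{ij}(x))$ symmetric positive semidefinite at each point; the coefficients are smooth near $\mu$-almost every point. Put $\Gamma(f,g)=\frac12\big(L(fg)-fLg-gLf\big)$ and $\Gamma(f)=\Gamma(f,f)$. Let $C^\infty(X)$ be the class of real functions that are smooth near $\mu$-almost every point. For $0\le W\in C^\infty(X)$ let $X'$ be the open set of points at which $L,W,W^{-1}$ are smooth and $W,W^{-1}>0$, and let $\mathcal A_0=C_c^\infty(X')$. Assume that $\mu$ is finite on compact subsets of $X'$ and reversible for $L$: $\int fLg\,d\mu=-\int\Gamma(f,g)\,d\mu$ for $f,g\in\mathcal A_0$. Let $(P_t)_{t\ge0}$ be a strongly continuous semigroup of self-adjoint contractions on $L^2(\mu)$ which is sub-Markov ($F\le1\Rightarrow P_tF\le1$) and whose (self-adjoint) generator extends $L$ on $\mathcal A_0$; any such extension is allowed. $P_s$ also denotes the induced contraction of $L^1(\mu)$. Let $\mathcal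 A_0(W)$ be the set of $f\in\mathcal A_0$ such that $$L P_s\big(W^2(P_tf)^2\big)=P_sL\big(W^2(P_tf)^2\big)\qquad\text{for all } s,t>0,$$ understood as an identity in $L^1(\mu)$ in the following sense: for every $t>0$, $P_tf$ has a version in $C^\infty(X)$; $u_t=W^2(P_tf)^2$ and the almost everywhere pointwise defined function $Lu_t$ belong to $L^1(\mu)$; the outer $L$ on the left-hand side acts in the sense of distributions on $X'$, i.e. $\int (P_su_t)\,L\varphi\,d\mu=\int (P_sLu_t)\,\varphi\,d\mu$ for $\varphi\in\mathcal A_0$; and $t\mapsto\|Lu_t\|_{L^1(\mu)}$ is locally integrable on $[0,\infty)$. **Theorem (the logarithmic $Q=2$ case).** Let $0\le\psi\in C^\infty(X)$ satisfy $L\psi=\frac{Q-1}{\psi}\Gamma(\psi)$ almost everywhere with $Q=2$. Suppose that either $\psi\le1$ and $\Phi=-\log\psi$, or $\psi\ge1$ and $\Phi=\log\psi$; that $0<\Phi<\infty$ almost everywhere; and that $W=\Phi^{-1/2}\in C^\infty(X)$. Let the setting above hold for this $W$, and write $\log^\alpha\psi:=|\log\psi|^\alpha$. Then the following are equivalent: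 1. $\|\Phi^{-1/2}P_tf\|_{L^2(\mu)}\le\|\Phi^{-1/2}f\|_{L^2(\mu)}$ for all $t\ge0$ and all $f\in\mathcal A_0(\Phi^{-1/2})$; 2. $\displaystyle\int\frac{\Gamma(\psi)}{\psi^2\log^2\psi}f^2\,d\mu\le4\int\Gamma(f)\,d\mu$ for all $f\in\mathcal A_0(\Phi^{-1/2})$. Moreover, for every real $\alpha\ne1$, both are equivalent to 3. $\displaystyle\int\log^\alpha\psi\,\frac{\Gamma(\psi)}{\psi^2\log^2\psi}f^2\,d\mu\le\Big(\frac{2}{\alpha-1}\Big)^2\int\log^\alpha\psi\,\Gamma(f)\,d\mu$ for all $f\in\mathcal A_0(\Phi^{-1/2})$. -/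

import Mathlib

open MeasureTheory Filter Topology
open scoped Manifold ContDiff

noncomputable section

namespace LogHardy

/-- The `i`-th partial derivative of a function on `ℝ^m`. -/
def pderiv {m : ℕ} (i : Fin m) (F : EuclideanSpace ℝ (Fin m) → ℝ)
    (y : EuclideanSpace ℝ (Fin m)) : ℝ :=
  fderiv ℝ F y (EuclideanSpace.single i 1)

/-- A diffusion on an `m`-dimensional manifold `X`: a second order differential operator
`∑ a_ij ∂_ij + ∑ b_i ∂_i` without zeroth order term whose second order part is symmetric and
positive semidefinite. The coefficients at the point `x` are those with respect to the
preferred chart `chartAt _ x`; see `DiffusionOperator.SmoothNear` for their smoothness. -/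
structure DiffusionOperator (m : ℕ) (X : Type*) [TopologicalSpace X]
    [ChartedSpace (EuclideanSpace ℝ (Fin m)) X] where
  a : X → Matrix (Fin m) (Fin m) ℝ
  b : X → Fin m → ℝ
  posSemidef : ∀ x, (a x).PosSemidef

section Smooth

variable {m : ℕ} {X : Type*} [TopologicalSpace X] [ChartedSpace (EuclideanSpace ℝ (Fin m)) X]

/-- `f` is smooth in a neighbourhood of `x`. -/
def SmoothNear (m : ℕ) {X : Type*} [TopologicalSpace X]
    [ChartedSpace (EuclideanSpace ℝ (Fin m)) X] (f : X → ℝ) (x : X) : Prop :=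
  ∀ᶠ y in 𝓝 x, ContMDiffAt (𝓡 m) 𝓘(ℝ, ℝ) ∞ f y

/-- The class `C^∞(X)` of functions which are smooth (near) almost every point. -/
def AESmooth (m : ℕ) {X : Type*} [TopologicalSpace X]
    [ChartedSpace (EuclideanSpace ℝ (Fin m)) X] [MeasurableSpace X]
    (μ : Measure X) (f : X → ℝ) : Prop :=
  ∀ᵐ x ∂μ, SmoothNear m f x

/-- The class `C_c^∞(U)`; its elements are extended by zero to `X`. -/
def IsTest (m : ℕ) {X : Type*} [TopologicalSpace X]
    [ChartedSpace (EuclideanSpace ℝ (Fin m)) X] (U : Set X) (f : X → ℝ) : Prop :=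
  ContMDiff (𝓡 m) 𝓘(ℝ, ℝ) ∞ f ∧ HasCompactSupport f ∧ tsupport f ⊆ U

namespace DiffusionOperator

/-- The value `(L f)(x)`, for `f` twice differentiable near `x`. -/
def apply (L : DiffusionOperator m X) (f : X → ℝ) (x : X) : ℝ :=
  let φ := chartAt (EuclideanSpace ℝ (Fin m)) x
  let F := f ∘ φ.symm
  (∑ i, ∑ j, L.a x i j * pderiv i (pderiv j F) (φ x)) + ∑ i, L.b x i * pderiv i F (φ x)

/-- The carré du champ `Γ(f, g) = (L(fg) - f L g - g L f) / 2`; `Γ(f)` is `Γ(f, f)`. -/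
def Gamma (L : DiffusionOperator m X) (f g : X → ℝ) (x : X) : ℝ :=
  (L.apply (fun y => f y * g y) x - f x * L.apply g x - g x * L.apply f x) / 2

/-- `L` is smooth in a neighbourhood of `x`: it maps functions that are smooth near a point to
functions that are smooth near that point (equivalently, its coefficients in a fixed chart are
smooth). -/
def SmoothNear (L : DiffusionOperator m X) (x : X) : Prop :=
  ∀ᶠ y in 𝓝 x, ∀ f : X → ℝ, LogHardy.SmoothNear m f y → LogHardy.SmoothNear m (L.apply f) y

/-- The set `X'` of points at which `L`, `W`, `W⁻¹` are smooth and `W, W⁻¹ > 0`. -/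
def regularSet (L : DiffusionOperator m X) (W : X → ℝ) : Set X :=
  {x | L.SmoothNear x ∧ LogHardy.SmoothNear m W x ∧ LogHardy.SmoothNear m (fun y => (W y)⁻¹) x ∧
    0 < W x ∧ 0 < (W x)⁻¹}

variable [MeasurableSpace X]

/-- `μ` is a reversible measure for `L` on the class `C_c^∞(U)`. -/
structure IsReversible (L : DiffusionOperator m X) (μ : Measure X) (U : Set X) : Prop where
  lt_top_of_isCompact : ∀ K : Set X, IsCompact K → K ⊆ U → μ K < ⊤
  integral_mul_apply : ∀ f g : X → ℝ, IsTest m U f → IsTest m U g →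
    ∫ x, f x * L.apply g x ∂μ = - ∫ x, L.Gamma f g x ∂μ

/-- The laplacian identity `L ψ = ((Q - 1) / ψ) Γ(ψ)`, almost everywhere. -/
def LaplacianIdentity (L : DiffusionOperator m X) (μ : Measure X) (Q : ℝ) (ψ : X → ℝ) : Prop :=
  ∀ᵐ x ∂μ, L.apply ψ x = (Q - 1) / ψ x * L.Gamma ψ ψ x

end DiffusionOperator

end Smooth

section Semigroup

variable {X : Type*} [MeasurableSpace X]

open Classical in
/-- The class in `L²(μ)` of a square integrable function (and `0` for any other function). -/
def l2Class (μ : Measure X) (f : X → ℝ) : Lp ℝ 2 μ :=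
  if h : MemLp f 2 μ then h.toLp f else 0

/-- `(P_t)_{t ≥ 0}` is a strongly continuous semigroup of self-adjoint contractions of `L²(μ)`
(so `P_t = e^{tA}` for a unique self-adjoint `A ≤ 0`) which is sub-Markov: `P_t F ≤ 1` if
`F ≤ 1`. Only the times `t ≥ 0` matter. -/
structure IsSymmetricSubMarkovSemigroup (μ : Measure X)
    (P : ℝ → Lp ℝ 2 μ →L[ℝ] Lp ℝ 2 μ) : Prop where
  zero : P 0 = ContinuousLinearMap.id ℝ (Lp ℝ 2 μ)
  add : ∀ s t : ℝ, 0 ≤ s → 0 ≤ t → P (s + t) = (P s).comp (P t)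
  symm : ∀ t : ℝ, 0 ≤ t → ∀ F G : Lp ℝ 2 μ, inner ℝ (P t F) G = inner ℝ F (P t G)
  contraction : ∀ t : ℝ, 0 ≤ t → ∀ F : Lp ℝ 2 μ, ‖P t F‖ ≤ ‖F‖
  tendsto_zero : ∀ F : Lp ℝ 2 μ, Tendsto (fun t => P t F) (𝓝[>] 0) (𝓝 F)
  subMarkov : ∀ t : ℝ, 0 ≤ t → ∀ F : Lp ℝ 2 μ, (∀ᵐ x ∂μ, F x ≤ 1) → ∀ᵐ x ∂μ, P t F x ≤ 1

/-- `v = P_s u` for integrable `u` and `v`: the action of a symmetric sub-Markov semigroup on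
`L¹(μ)`, that is `∫ v φ dμ = ∫ u P_s φ dμ` for all `φ` in `L²(μ) ∩ L^∞(μ)`. -/
def IsL1Image (μ : Measure X) (P : ℝ → Lp ℝ 2 μ →L[ℝ] Lp ℝ 2 μ) (s : ℝ) (u v : X → ℝ) : Prop :=
  Integrable u μ ∧ Integrable v μ ∧
    ∀ φ : Lp ℝ 2 μ, (∃ C : ℝ, ∀ᵐ x ∂μ, |φ x| ≤ C) →
      ∫ x, v x * φ x ∂μ = ∫ x, u x * P s φ x ∂μ

end Semigroup

namespace DiffusionOperator

variable {m : ℕ} {X : Type*} [TopologicalSpace X] [ChartedSpace (EuclideanSpace ℝ (Fin m)) X]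
  [MeasurableSpace X]

/-- The generator of `(P_t)` extends `L` on `C_c^∞(U)`: for `f` in `C_c^∞(U)`,
`(P_t f - f) / t → L f` in `L²(μ)` as `t ↓ 0`. -/
def Generates (L : DiffusionOperator m X) (μ : Measure X) (U : Set X)
    (P : ℝ → Lp ℝ 2 μ →L[ℝ] Lp ℝ 2 μ) : Prop :=
  ∀ f : X → ℝ, IsTest m U f →
    Tendsto (fun t : ℝ => t⁻¹ • (P t (l2Class μ f) - l2Class μ f)) (𝓝[>] 0)
      (𝓝 (l2Class μ (L.apply f)))

/-- The identity `L P_s u = P_s L u` in `L¹(μ)`. On the right `L u` is computed pointwise almost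
everywhere; on the left `L` acts in the sense of distributions on `U`. -/
def CommutesAt (L : DiffusionOperator m X) (μ : Measure X) (U : Set X)
    (P : ℝ → Lp ℝ 2 μ →L[ℝ] Lp ℝ 2 μ) (s : ℝ) (u : X → ℝ) : Prop :=
  ∃ p q : X → ℝ, IsL1Image μ P s u p ∧ IsL1Image μ P s (L.apply u) q ∧
    ∀ φ : X → ℝ, IsTest m U φ → ∫ x, p x * L.apply φ x ∂μ = ∫ x, q x * φ x ∂μ

/-- The class `𝒜₀(W)` of those `f` in `C_c^∞(X')` such that
`L P_s (W² (P_t f)²) = P_s L (W² (P_t f)²)` for all `s, t > 0`, as an identity in `L¹(μ)`: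
`P_t f` has an almost everywhere smooth version `g t`, so that `L (W² (P_t f)²)` makes sense,
and `t ↦ L (W² (P_t f)²)` is an `L¹(μ)`-valued function with norm locally integrable on
`[0, ∞)`. -/
def MemA0 (L : DiffusionOperator m X) (μ : Measure X)
    (P : ℝ → Lp ℝ 2 μ →L[ℝ] Lp ℝ 2 μ) (W f : X → ℝ) : Prop :=
  IsTest m (L.regularSet W) f ∧
  ∃ g : ℝ → X → ℝ,
    (∀ t : ℝ, 0 < t → g t =ᵐ[μ] P t (l2Class μ f)) ∧
    (∀ t : ℝ, 0 < t → AESmooth m μ (g t)) ∧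
    (∀ s t : ℝ, 0 < s → 0 < t →
      L.CommutesAt μ (L.regularSet W) P s (fun x => W x ^ 2 * g t x ^ 2)) ∧
    ∀ T : ℝ, 0 < T → IntervalIntegrable
      (fun t => ∫ x, |L.apply (fun y => W y ^ 2 * g t y ^ 2) x| ∂μ) volume 0 T

end DiffusionOperator

end LogHardy

end

/-! For `Q = 2` the identity for `ψ` says exactly that `log ψ` is `L`-harmonic
(`apply_log_eq_zero`). Thus `Φ = |log ψ|` is a positive harmonic function on the regular set, and
`Γ(ψ) / (ψ² log² ψ) = Γ(Φ) / Φ²`. Under the standing hypotheses this makes all three statements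
true, and the equivalences follow.

Hardy inequalities (`integral_hardy_le`): harmonicity gives `∫ Γ(f² Φ^(α-1), Φ) = 0`. Expanding the
integrand and completing the square against `Γ(f)` gives the weighted inequality for every `α ≠ 1`;
`α = 0` is statement 2.

Contraction (`eLpNorm_weighted_semigroup_le`): let `g = P_t f`, `h = g / Φ` and `u = g² / Φ = Φ h²`.
Since `L Φ = 0`, one has `L u = 2 h L g + 2 Φ Γ(h) ≥ 2 g L g / Φ` (`two_mul_le_apply_weighted_sq`),
so formally the derivative of `∫ g² / Φ` is at most `∫ L u`. The commutation `L P_s u = P_s L u`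
makes `∫ L u` the initial rate of change of the mass `∫ P_s u`, which a sub-Markov semigroup cannot
increase, so `∫ L u ≤ 0` (`integral_nonpos_of_commutes`). Since `1 / Φ` may be unbounded, the
derivative is taken with truncated weights (`integral_weighted_sq_le`). -/

namespace LogHardy

/-! ### Product and chain rules for partial derivatives. -/

section Euclidean

variable {m : ℕ} {F G : EuclideanSpace ℝ (Fin m) → ℝ} {y : EuclideanSpace ℝ (Fin m)}

theorem pderiv_congr (h : F =ᶠ[𝓝 y] G) (i : Fin m) : pderiv i F y = pderiv i G y := by
  simp [pderiv, h.fderiv_eq]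

theorem pderiv_eventuallyEq (h : F =ᶠ[𝓝 y] G) (i : Fin m) : pderiv i F =ᶠ[𝓝 y] pderiv i G := by
  filter_upwards [h.eventuallyEq_nhds] with z hz using pderiv_congr hz i

theorem pderiv_add (hF : DifferentiableAt ℝ F y) (hG : DifferentiableAt ℝ G y) (i : Fin m) :
    pderiv i (fun z => F z + G z) y = pderiv i F y + pderiv i G y := by
  simp [pderiv, fderiv_fun_add hF hG]

theorem pderiv_neg (i : Fin m) : pderiv i (fun z => -F z) y = -pderiv i F y := by
  simp [pderiv, fderiv_fun_neg]

theorem pderiv_mul (hF : DifferentiableAt ℝ F y) (hG : DifferentiableAt ℝ G y) (i : Fin m) :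
    pderiv i (fun z => F z * G z) y = F y * pderiv i G y + G y * pderiv i F y := by
  simp [pderiv, fderiv_fun_mul hF hG]

theorem pderiv_comp {θ : ℝ → ℝ} {θ' : ℝ} (hθ : HasDerivAt θ θ' (F y))
    (hF : DifferentiableAt ℝ F y) (i : Fin m) :
    pderiv i (fun z => θ (F z)) y = θ' * pderiv i F y := by
  have h : HasFDerivAt (fun z => θ (F z)) (θ' • fderiv ℝ F y) y :=
    hθ.comp_hasFDerivAt y hF.hasFDerivAt
  simp [pderiv, h.fderiv]

theorem differentiableAt_pderiv (hF : ContDiffAt ℝ ∞ F y) (i : Fin m) :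
    DifferentiableAt ℝ (pderiv i F) y := by
  have h : ContDiffAt ℝ 1 (fderiv ℝ F) y := hF.fderiv_right (by norm_cast)
  exact (h.differentiableAt (by norm_num)).clm_apply (differentiableAt_const _)

theorem eventually_differentiableAt (hF : ContDiffAt ℝ ∞ F y) :
    ∀ᶠ z in 𝓝 y, DifferentiableAt ℝ F z := by
  have h : ContDiffAt ℝ 1 F y := hF.of_le (by norm_cast)
  filter_upwards [h.eventually (by norm_num)] with z hz using hz.differentiableAt (by norm_num)

theorem pderiv_pderiv_mul (hF : ContDiffAt ℝ ∞ F y) (hG : ContDiffAt ℝ ∞ G y) (i j : Fin m) :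
    pderiv i (pderiv j fun z => F z * G z) y =
      F y * pderiv i (pderiv j G) y + G y * pderiv i (pderiv j F) y +
        (pderiv i F y * pderiv j G y + pderiv i G y * pderiv j F y) := by
  have hF' := (eventually_differentiableAt hF).self_of_nhds
  have hG' := (eventually_differentiableAt hG).self_of_nhds
  have h : pderiv j (fun z => F z * G z) =ᶠ[𝓝 y]
      fun z => F z * pderiv j G z + G z * pderiv j F z := by
    filter_upwards [eventually_differentiableAt hF, eventually_differentiableAt hG] with z h1 h2
      using pderiv_mul h1 h2 j
  rw [pderiv_congr h, pderiv_add (hF'.fun_mul (differentiableAt_pderiv hG j))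
    (hG'.fun_mul (differentiableAt_pderiv hF j)), pderiv_mul hF' (differentiableAt_pderiv hG j),
    pderiv_mul hG' (differentiableAt_pderiv hF j)]
  ring

/-- The exponential is the only function needing a second order chain rule, through `ψ = exp (log
ψ)`. Powers of `Φ` only enter `Γ`, which is of first order. -/
theorem pderiv_pderiv_exp (hF : ContDiffAt ℝ ∞ F y) (i j : Fin m) :
    pderiv i (pderiv j fun z => Real.exp (F z)) y =
      Real.exp (F y) * (pderiv i (pderiv j F) y + pderiv i F y * pderiv j F y) := by
  have hF' := (eventually_differentiableAt hF).self_of_nhds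
  have h : pderiv j (fun z => Real.exp (F z)) =ᶠ[𝓝 y] fun z => Real.exp (F z) * pderiv j F z := by
    filter_upwards [eventually_differentiableAt hF] with z h1
      using pderiv_comp (Real.hasDerivAt_exp _) h1 j
  rw [pderiv_congr h, pderiv_mul hF'.exp (differentiableAt_pderiv hF j),
    pderiv_comp (Real.hasDerivAt_exp _) hF']
  ring

end Euclidean

/-! ### Pointwise calculus of `L` and `Γ` in the preferred chart. -/

section Chart

variable {m : ℕ} {X : Type*} [TopologicalSpace X] [ChartedSpace (EuclideanSpace ℝ (Fin m)) X]
  {f g h : X → ℝ} {x : X}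

/-- The gradient of `f` at `x` in the preferred chart at `x`. -/
noncomputable def chartGrad (m : ℕ) {X : Type*}
    [TopologicalSpace X] [ChartedSpace (EuclideanSpace ℝ (Fin m)) X]
    (f : X → ℝ) (x : X) : Fin m → ℝ := fun i =>
  pderiv i (f ∘ (chartAt (EuclideanSpace ℝ (Fin m)) x).symm)
    (chartAt (EuclideanSpace ℝ (Fin m)) x x)

theorem SmoothNear.contDiffAt (hf : SmoothNear m f x) :
    ContDiffAt ℝ ∞ (f ∘ (chartAt (EuclideanSpace ℝ (Fin m)) x).symm)
      (chartAt (EuclideanSpace ℝ (Fin m)) x x) := by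
  have h := (contMDiffAt_iff.1 hf.self_of_nhds).2
  simpa only [extChartAt_model_space_eq_id, PartialEquiv.refl_coe, Function.id_comp, mfld_simps,
    contDiffWithinAt_univ, Function.comp_def, id_eq, chartAt_self_eq] using h

theorem comp_chart_symm_eventuallyEq (h : f =ᶠ[𝓝 x] g) :
    f ∘ (chartAt (EuclideanSpace ℝ (Fin m)) x).symm =ᶠ[𝓝 (chartAt (EuclideanSpace ℝ (Fin m)) x x)]
      g ∘ (chartAt (EuclideanSpace ℝ (Fin m)) x).symm := by
  have hc := (chartAt (EuclideanSpace ℝ (Fin m)) x).continuousAt_symm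
    (mem_chart_target (EuclideanSpace ℝ (Fin m)) x)
  rw [ContinuousAt, (chartAt (EuclideanSpace ℝ (Fin m)) x).left_inv (mem_chart_source _ x)] at hc
  exact hc.eventually h

@[simp] theorem chart_symm_chart :
    (chartAt (EuclideanSpace ℝ (Fin m)) x).symm (chartAt (EuclideanSpace ℝ (Fin m)) x x) = x :=
  (chartAt (EuclideanSpace ℝ (Fin m)) x).left_inv (mem_chart_source _ x)

theorem SmoothNear.differentiableAt (hf : SmoothNear m f x) :
    DifferentiableAt ℝ (f ∘ (chartAt (EuclideanSpace ℝ (Fin m)) x).symm)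
      (chartAt (EuclideanSpace ℝ (Fin m)) x x) :=
  (eventually_differentiableAt hf.contDiffAt).self_of_nhds

theorem chartGrad_mul (hf : SmoothNear m f x) (hg : SmoothNear m g x) :
    chartGrad m (fun y => f y * g y) x = f x • chartGrad m g x + g x • chartGrad m f x := by
  funext i
  have := pderiv_mul hf.differentiableAt hg.differentiableAt i
  simpa [chartGrad, Function.comp_def] using this

theorem chartGrad_comp {θ : ℝ → ℝ} {θ' : ℝ} (hθ : HasDerivAt θ θ' (f x)) (hf : SmoothNear m f x) :
    chartGrad m (fun y => θ (f y)) x = θ' • chartGrad m f x := by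
  funext i
  exact pderiv_comp (F := f ∘ (chartAt (EuclideanSpace ℝ (Fin m)) x).symm) (by simpa using hθ)
    hf.differentiableAt i

namespace DiffusionOperator

variable (L : DiffusionOperator m X)

theorem apply_congr (h : f =ᶠ[𝓝 x] g) : L.apply f x = L.apply g x := by
  have h' := comp_chart_symm_eventuallyEq (m := m) h
  simp only [apply]
  congr 1
  · exact Finset.sum_congr rfl fun i _ => Finset.sum_congr rfl fun j _ => by
      rw [pderiv_congr (pderiv_eventuallyEq h' j) i]
  · exact Finset.sum_congr rfl fun i _ => by rw [pderiv_congr h' i]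

theorem apply_neg : L.apply (fun y => -f y) x = -L.apply f x := by
  have h (j : Fin m) (F : EuclideanSpace ℝ (Fin m) → ℝ) :
      pderiv j (fun z => -F z) = fun z => -pderiv j F z := funext fun z => pderiv_neg j
  simp only [apply, Function.comp_def, h, mul_neg, Finset.sum_neg_distrib]
  ring

theorem sum_sum_eq_dotProduct (v w : Fin m → ℝ) :
    ∑ i, ∑ j, L.a x i j * (v i * w j) = v ⬝ᵥ (L.a x).mulVec w := by
  simp only [dotProduct, Matrix.mulVec, Finset.mul_sum]
  exact Finset.sum_congr rfl fun i _ => Finset.sum_congr rfl fun j _ => by ring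

theorem dotProduct_mulVec_comm (v w : Fin m → ℝ) :
    v ⬝ᵥ (L.a x).mulVec w = w ⬝ᵥ (L.a x).mulVec v := by
  have h : (L.a x).transpose = L.a x := by
    have := (L.posSemidef x).isHermitian
    rwa [Matrix.IsHermitian, Matrix.conjTranspose_eq_transpose_of_trivial] at this
  rw [Matrix.dotProduct_mulVec, ← Matrix.mulVec_transpose, h, dotProduct_comm]

/-- The two cross terms of the second order product rule coincide because `a` is symmetric. -/
theorem apply_mul (hf : LogHardy.SmoothNear m f x) (hg : LogHardy.SmoothNear m g x) :
    L.apply (fun y => f y * g y) x = f x * L.apply g x + g x * L.apply f x +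
      2 * (chartGrad m f x ⬝ᵥ (L.a x).mulVec (chartGrad m g x)) := by
  have h2 : ∀ v w : Fin m → ℝ, 2 * (v ⬝ᵥ (L.a x).mulVec w) =
      ∑ i, ∑ j, L.a x i j * (v i * w j + w i * v j) := by
    intro v w
    simp_rw [mul_add, Finset.sum_add_distrib, L.sum_sum_eq_dotProduct]
    rw [L.dotProduct_mulVec_comm w v]; ring
  rw [h2]
  have e (i j : Fin m) := pderiv_pderiv_mul hf.contDiffAt hg.contDiffAt i j
  have e' (i : Fin m) := pderiv_mul hf.differentiableAt hg.differentiableAt i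
  simp only [Function.comp_apply, chart_symm_chart] at e e'
  simp only [apply, Function.comp_def] at e e' ⊢
  simp only [e, e', mul_add, Finset.sum_add_distrib, Finset.mul_sum, chartGrad, Function.comp_def]
  simp only [mul_left_comm (L.a x _ _), mul_left_comm (L.b x _)]
  ring

/-- The first order form of `Γ` yields its Leibniz rule, its chain rule and its positivity. -/
theorem Gamma_eq (hf : LogHardy.SmoothNear m f x) (hg : LogHardy.SmoothNear m g x) :
    L.Gamma f g x = chartGrad m f x ⬝ᵥ (L.a x).mulVec (chartGrad m g x) := by
  rw [Gamma, L.apply_mul hf hg]; ring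

theorem Gamma_comm (f g : X → ℝ) (x : X) : L.Gamma f g x = L.Gamma g f x := by
  simp only [Gamma, mul_comm (f _)]; ring

theorem Gamma_congr {f' g' : X → ℝ} (hf : f =ᶠ[𝓝 x] f') (hg : g =ᶠ[𝓝 x] g') :
    L.Gamma f g x = L.Gamma f' g' x := by
  rw [Gamma, Gamma, L.apply_congr hf, L.apply_congr hg, hf.self_of_nhds, hg.self_of_nhds,
    L.apply_congr (hf.fun_mul hg)]

theorem apply_mul_eq_add_Gamma (f g : X → ℝ) (x : X) :
    L.apply (fun y => f y * g y) x = f x * L.apply g x + g x * L.apply f x + 2 * L.Gamma f g x := by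
  rw [Gamma]; ring

theorem Gamma_mul (hf : LogHardy.SmoothNear m f x) (hg : LogHardy.SmoothNear m g x)
    (hh : LogHardy.SmoothNear m h x) (hfg : LogHardy.SmoothNear m (fun y => f y * g y) x) :
    L.Gamma h (fun y => f y * g y) x = f x * L.Gamma h g x + g x * L.Gamma h f x := by
  rw [L.Gamma_eq hh hfg, L.Gamma_eq hh hg, L.Gamma_eq hh hf, chartGrad_mul hf hg,
    Matrix.mulVec_add, Matrix.mulVec_smul, Matrix.mulVec_smul, dotProduct_add, dotProduct_smul,
    dotProduct_smul, smul_eq_mul, smul_eq_mul]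

theorem Gamma_comp {θ : ℝ → ℝ} {θ' : ℝ} (hθ : HasDerivAt θ θ' (f x))
    (hf : LogHardy.SmoothNear m f x) (hg : LogHardy.SmoothNear m g x)
    (hθf : LogHardy.SmoothNear m (fun y => θ (f y)) x) :
    L.Gamma g (fun y => θ (f y)) x = θ' * L.Gamma g f x := by
  rw [L.Gamma_eq hg hθf, L.Gamma_eq hg hf, chartGrad_comp hθ hf, Matrix.mulVec_smul,
    dotProduct_smul, smul_eq_mul]

theorem dotProduct_mulVec_nonneg (v : Fin m → ℝ) : 0 ≤ v ⬝ᵥ (L.a x).mulVec v := by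
  simpa using (L.posSemidef x).dotProduct_mulVec_nonneg v

theorem Gamma_self_nonneg (hf : LogHardy.SmoothNear m f x) : 0 ≤ L.Gamma f f x := by
  rw [L.Gamma_eq hf hf]; exact L.dotProduct_mulVec_nonneg _

/-- Positivity of the carré du champ of `f - c g`, for a constant `c`. -/
theorem two_mul_Gamma_le (hf : LogHardy.SmoothNear m f x) (hg : LogHardy.SmoothNear m g x) (c : ℝ) :
    2 * c * L.Gamma f g x - c ^ 2 * L.Gamma g g x ≤ L.Gamma f f x := by
  -- Only gradients at `x` enter, so `c` may be the value at `x` of a function; the Hardy inequality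
  -- takes `β f / Φ`.
  have h := L.dotProduct_mulVec_nonneg (x := x) (chartGrad m f x - c • chartGrad m g x)
  rw [Matrix.mulVec_sub, Matrix.mulVec_smul, sub_dotProduct, dotProduct_sub, dotProduct_sub,
    smul_dotProduct, smul_dotProduct, dotProduct_smul, dotProduct_smul,
    L.dotProduct_mulVec_comm (chartGrad m g x), ← L.Gamma_eq hf hf, ← L.Gamma_eq hf hg,
    ← L.Gamma_eq hg hg] at h
  simp only [smul_eq_mul] at h
  linarith

theorem apply_exp (hf : LogHardy.SmoothNear m f x) :
    L.apply (fun y => Real.exp (f y)) x = Real.exp (f x) * (L.apply f x + L.Gamma f f x) := by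
  rw [L.Gamma_eq hf hf, ← L.sum_sum_eq_dotProduct]
  have e (i j : Fin m) := pderiv_pderiv_exp hf.contDiffAt i j
  have e' (i : Fin m) := pderiv_comp (Real.hasDerivAt_exp _) hf.differentiableAt i
  simp only [Function.comp_apply, chart_symm_chart] at e e'
  simp only [apply, Function.comp_def] at e e' ⊢
  simp only [e, e', mul_add, Finset.sum_add_distrib, Finset.mul_sum, chartGrad, Function.comp_def]
  simp only [mul_left_comm (L.a x _ _), mul_left_comm (L.b x _)]
  ring

end DiffusionOperator

end Chart

/-! ### Stability of local smoothness, and locality of `L` and `Γ`. -/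

section SmoothNear

variable {m : ℕ} {X : Type*} [TopologicalSpace X] [ChartedSpace (EuclideanSpace ℝ (Fin m)) X]
  {f g : X → ℝ} {x : X}

theorem SmoothNear.eventually (hf : SmoothNear m f x) : ∀ᶠ y in 𝓝 x, SmoothNear m f y :=
  eventually_eventually_nhds.2 hf

theorem SmoothNear.continuousAt (hf : SmoothNear m f x) : ContinuousAt f x :=
  hf.self_of_nhds.continuousAt

theorem SmoothNear.congr (hf : SmoothNear m f x) (h : f =ᶠ[𝓝 x] g) : SmoothNear m g x := by
  filter_upwards [hf, h.eventuallyEq_nhds] with y hy h' using hy.congr_of_eventuallyEq h'.symm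

theorem smoothNear_const (c : ℝ) : SmoothNear m (fun _ : X => c) x :=
  Eventually.of_forall fun _ => contMDiffAt_const

theorem SmoothNear.mul (hf : SmoothNear m f x) (hg : SmoothNear m g x) :
    SmoothNear m (fun y => f y * g y) x := by
  filter_upwards [hf, hg] with y h1 h2
  exact h1.mul h2

theorem SmoothNear.sub (hf : SmoothNear m f x) (hg : SmoothNear m g x) :
    SmoothNear m (fun y => f y - g y) x := by
  filter_upwards [hf, hg] with y h1 h2
  exact h1.sub h2

theorem SmoothNear.comp {θ : ℝ → ℝ} (hθ : ∀ᶠ z in 𝓝 (f x), ContDiffAt ℝ ∞ θ z)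
    (hf : SmoothNear m f x) : SmoothNear m (fun y => θ (f y)) x := by
  filter_upwards [hf, hf.continuousAt.eventually hθ] with y h1 h2
  exact h2.contMDiffAt.comp y h1

theorem SmoothNear.neg (hf : SmoothNear m f x) : SmoothNear m (fun y => -f y) x :=
  hf.comp (θ := fun z => -z) (Eventually.of_forall fun _ => contDiffAt_id.neg)

theorem _root_.ContMDiff.smoothNear (hf : ContMDiff (𝓡 m) 𝓘(ℝ, ℝ) ∞ f) (x : X) :
    SmoothNear m f x :=
  Eventually.of_forall fun y => hf y

theorem isOpen_setOf_smoothNear (f : X → ℝ) : IsOpen {x | SmoothNear m f x} :=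
  isOpen_iff_mem_nhds.2 fun _ hx => SmoothNear.eventually hx

namespace DiffusionOperator

variable {L : DiffusionOperator m X} {W : X → ℝ}

theorem SmoothNear.apply (hL : L.SmoothNear x) (hf : LogHardy.SmoothNear m f x) :
    LogHardy.SmoothNear m (L.apply f) x :=
  hL.self_of_nhds f hf

theorem SmoothNear.Gamma (hL : L.SmoothNear x) (hf : LogHardy.SmoothNear m f x)
    (hg : LogHardy.SmoothNear m g x) : LogHardy.SmoothNear m (L.Gamma f g) x := by
  have h := (smoothNear_const (x := x) (1 / 2 : ℝ)).mul
    (((hL.apply (hf.mul hg)).sub (hf.mul (hL.apply hg))).sub (hg.mul (hL.apply hf)))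
  refine h.congr (Eventually.of_forall fun y => ?_)
  simp only [DiffusionOperator.Gamma]
  ring

theorem isOpen_regularSet (L : DiffusionOperator m X) (W : X → ℝ) : IsOpen (L.regularSet W) := by
  refine isOpen_iff_mem_nhds.2 fun x hx => ?_
  obtain ⟨hL, hW, hW', hpos, -⟩ := hx
  filter_upwards [eventually_eventually_nhds.2 hL, hW.eventually, hW'.eventually,
    hW.continuousAt.eventually (lt_mem_nhds hpos)] with y h1 h2 h3 h4
  exact ⟨h1, h2, h3, h4, inv_pos.2 h4⟩

@[simp] theorem apply_zero (L : DiffusionOperator m X) (x : X) : L.apply (fun _ => 0) x = 0 := by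
  have h (j : Fin m) : pderiv j (fun _ : EuclideanSpace ℝ (Fin m) => (0 : ℝ)) = fun _ => 0 := by
    funext z; simp [pderiv]
  simp [apply, Function.comp_def, h]

theorem apply_eq_zero (L : DiffusionOperator m X) (h : f =ᶠ[𝓝 x] fun _ => 0) :
    L.apply f x = 0 := by
  rw [L.apply_congr h, apply_zero]

theorem Gamma_eq_zero (L : DiffusionOperator m X) (h : f =ᶠ[𝓝 x] fun _ => 0) :
    L.Gamma f g x = 0 := by
  have h' : (fun y => f y * g y) =ᶠ[𝓝 x] fun _ => 0 := by filter_upwards [h] with y hy; simp [hy]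
  rw [Gamma, L.apply_eq_zero h, L.apply_eq_zero h', h.self_of_nhds]; ring

end DiffusionOperator

end SmoothNear

/-! ### Test functions and cutoffs. -/

section IsTest

variable {m : ℕ} {X : Type*} [TopologicalSpace X] [ChartedSpace (EuclideanSpace ℝ (Fin m)) X]
  {U V : Set X} {f g φ : X → ℝ} {x : X}

theorem IsTest.mono (hf : IsTest m U f) (h : U ⊆ V) : IsTest m V f :=
  ⟨hf.1, hf.2.1, hf.2.2.trans h⟩

theorem IsTest.smoothNear (hf : IsTest m U f) (x : X) : SmoothNear m f x := hf.1.smoothNear x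

theorem IsTest.exists_bound (hf : IsTest m U f) : ∃ C, ∀ x, |f x| ≤ C :=
  hf.2.1.exists_bound_of_continuous hf.1.continuous

/-- A point outside `U` has the open complement of `tsupport φ` as a neighbourhood, where `f`
vanishes; smoothness is thus only at stake on `U`. -/
theorem isTest_of_eq_zero (hφ : IsTest m U φ) (hs : ∀ x ∈ U, SmoothNear m f x)
    (h0 : ∀ x, x ∉ tsupport φ → f x = 0) : IsTest m U f := by
  have hsub : tsupport f ⊆ tsupport φ :=
    closure_minimal (fun x hx => by_contra fun h => hx (h0 x h)) (isClosed_tsupport φ)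
  refine ⟨fun x => ?_, hφ.2.1.mono' (subset_tsupport f |>.trans hsub), hsub.trans hφ.2.2⟩
  by_cases hx : x ∈ U
  · exact (hs x hx).self_of_nhds
  · have : (tsupport φ)ᶜ ∈ 𝓝 x :=
      (isClosed_tsupport φ).isOpen_compl.mem_nhds fun h => hx (hφ.2.2 h)
    refine (contMDiffAt_const (c := (0 : ℝ))).congr_of_eventuallyEq ?_
    filter_upwards [this] with y hy using h0 y hy

theorem eventuallyEq_zero_of_notMem_tsupport (hx : x ∉ tsupport φ) : φ =ᶠ[𝓝 x] fun _ => 0 := by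
  filter_upwards [(isClosed_tsupport φ).isOpen_compl.mem_nhds hx] with y hy
    using image_eq_zero_of_notMem_tsupport hy

theorem IsTest.mul_smooth (hφ : IsTest m U φ) (hs : ∀ x ∈ U, SmoothNear m f x) :
    IsTest m U (fun x => φ x * f x) :=
  isTest_of_eq_zero hφ (fun x hx => (hφ.smoothNear x).mul (hs x hx)) fun x hx => by
    simp [image_eq_zero_of_notMem_tsupport hx]

theorem IsTest.apply {L : DiffusionOperator m X} (hφ : IsTest m U φ)
    (hL : ∀ x ∈ U, L.SmoothNear x) : IsTest m U (L.apply φ) :=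
  isTest_of_eq_zero hφ (fun x hx => (hL x hx).apply (hφ.smoothNear x)) fun _ hx =>
    L.apply_eq_zero (eventuallyEq_zero_of_notMem_tsupport hx)

theorem IsTest.Gamma {L : DiffusionOperator m X} (hφ : IsTest m U φ)
    (hL : ∀ x ∈ U, L.SmoothNear x) (hs : ∀ x ∈ U, SmoothNear m f x) :
    IsTest m U (L.Gamma φ f) :=
  isTest_of_eq_zero hφ (fun x hx => (hL x hx).Gamma (hφ.smoothNear x) (hs x hx)) fun _ hx =>
    L.Gamma_eq_zero (eventuallyEq_zero_of_notMem_tsupport hx)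

/-- Smooth cutoff functions. -/
theorem exists_isTest_eq_one [T2Space X] [SecondCountableTopology X] [IsManifold (𝓡 m) ∞ X]
    (hU : IsOpen U) {K : Set X} (hK : IsCompact K) (hKU : K ⊆ U) :
    ∃ χ : X → ℝ, IsTest m U χ ∧ (∀ x ∈ K, χ =ᶠ[𝓝 x] fun _ => 1) ∧ ∀ x, 0 ≤ χ x ∧ χ x ≤ 1 := by
  have : LocallyCompactSpace X := ChartedSpace.locallyCompactSpace (EuclideanSpace ℝ (Fin m)) X
  obtain ⟨K', hK', hKK', hK'U⟩ := exists_compact_between hK hU hKU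
  obtain ⟨χ, h1, h0, h01⟩ := exists_contMDiffMap_one_nhds_of_subset_interior (n := ⊤) (𝓡 m)
    hK.isClosed hKK'
  have hsub : tsupport χ ⊆ K' :=
    closure_minimal (fun x hx => by_contra fun h => hx (h0 x h)) hK'.isClosed
  refine ⟨χ, ⟨χ.contMDiff, hK'.of_isClosed_subset (isClosed_tsupport _) hsub, hsub.trans hK'U⟩,
    fun x hx => ?_, h01⟩
  exact eventually_nhdsSet_iff_forall.1 h1 x hx

section Measure

variable [MeasurableSpace X] [BorelSpace X] {μ : Measure X}

theorem IsTest.integrable [SecondCountableTopology X]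
    (hμ : ∀ K : Set X, IsCompact K → K ⊆ U → μ K < ⊤) (hf : IsTest m U f) :
    Integrable f μ := by
  obtain ⟨C, hC⟩ := hf.exists_bound
  rw [← integrableOn_iff_integrable_of_support_subset (subset_tsupport f)]
  exact Measure.integrableOn_of_bounded (hμ _ hf.2.1 hf.2.2).ne
    hf.1.continuous.aestronglyMeasurable (Eventually.of_forall hC)

theorem IsTest.memLp_two [SecondCountableTopology X]
    (hμ : ∀ K : Set X, IsCompact K → K ⊆ U → μ K < ⊤)
    (hf : IsTest m U f) : MemLp f 2 μ := by
  rw [memLp_two_iff_integrable_sq hf.1.continuous.aestronglyMeasurable]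
  refine (IsTest.integrable hμ (hf.mul_smooth fun x _ => hf.smoothNear x)).congr ?_
  exact Eventually.of_forall fun x => (sq (f x)).symm

end Measure

end IsTest

/-! ### Integration by parts and the Hardy inequality. -/

section Reversible

variable {m : ℕ} {X : Type*} [TopologicalSpace X] [ChartedSpace (EuclideanSpace ℝ (Fin m)) X]
  [MeasurableSpace X] {μ : Measure X} {L : DiffusionOperator m X} {U V : Set X} {f g φ : X → ℝ}

namespace DiffusionOperator.IsReversible

theorem mono (h : L.IsReversible μ U) (hVU : V ⊆ U) : L.IsReversible μ V :=
  ⟨fun K hK hKV => h.1 K hK (hKV.trans hVU), fun f g hf hg =>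
    h.2 f g (hf.mono hVU) (hg.mono hVU)⟩

theorem integral_mul_apply_comm (h : L.IsReversible μ U) (hf : IsTest m U f) (hg : IsTest m U g) :
    ∫ x, f x * L.apply g x ∂μ = ∫ x, g x * L.apply f x ∂μ := by
  rw [h.2 f g hf hg, h.2 g f hg hf]
  simp_rw [L.Gamma_comm f g]

variable [T2Space X] [SecondCountableTopology X] [IsManifold (𝓡 m) ∞ X]

/-- Integration by parts, for a test function and a function which is only smooth. -/
theorem integral_mul_apply_of_smooth (h : L.IsReversible μ U) (hU : IsOpen U)
    (hφ : IsTest m U φ) (hg : ∀ x ∈ U, LogHardy.SmoothNear m g x) :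
    ∫ x, φ x * L.apply g x ∂μ = - ∫ x, L.Gamma φ g x ∂μ ∧
      ∫ x, φ x * L.apply g x ∂μ = ∫ x, g x * L.apply φ x ∂μ := by
  -- Since `χ = 1` near the support of `φ`, locality lets the test function `χ g` replace `g` in
  -- every integral.
  obtain ⟨χ, hχ, hχ1, -⟩ := exists_isTest_eq_one (m := m) hU hφ.2.1 hφ.2.2
  have hχg := hχ.mul_smooth hg
  have he : ∀ x ∈ tsupport φ, (fun y => χ y * g y) =ᶠ[𝓝 x] g := fun x hx => by
    filter_upwards [hχ1 x hx] with y hy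
    simp [hy]
  have e1 : ∀ x, φ x * L.apply (fun y => χ y * g y) x = φ x * L.apply g x := fun x => by
    by_cases hx : x ∈ tsupport φ
    · rw [L.apply_congr (he x hx)]
    · simp [image_eq_zero_of_notMem_tsupport hx]
  have e2 : ∀ x, L.Gamma φ (fun y => χ y * g y) x = L.Gamma φ g x := fun x => by
    by_cases hx : x ∈ tsupport φ
    · rw [L.Gamma_congr EventuallyEq.rfl (he x hx)]
    · rw [L.Gamma_eq_zero (eventuallyEq_zero_of_notMem_tsupport hx),
        L.Gamma_eq_zero (eventuallyEq_zero_of_notMem_tsupport hx)]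
  have e3 : ∀ x, χ x * g x * L.apply φ x = g x * L.apply φ x := fun x => by
    by_cases hx : x ∈ tsupport φ
    · simp [(hχ1 x hx).self_of_nhds]
    · simp [L.apply_eq_zero (eventuallyEq_zero_of_notMem_tsupport hx)]
  have h1 := h.2 φ _ hφ hχg
  have h2 := h.integral_mul_apply_comm hφ hχg
  simp only [e1, e2, e3] at h1 h2
  exact ⟨h1, h2⟩

end DiffusionOperator.IsReversible

/-- The weighted Hardy inequality attached to a positive `L`-harmonic function. -/
theorem integral_hardy_le [T2Space X] [SecondCountableTopology X] [IsManifold (𝓡 m) ∞ X]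
    [BorelSpace X] (h : L.IsReversible μ U) (hU : IsOpen U)
    (hL : ∀ x ∈ U, L.SmoothNear x) {Φ : X → ℝ} (hΦ : ∀ x ∈ U, SmoothNear m Φ x)
    (hpos : ∀ x ∈ U, 0 < Φ x) (hharm : ∀ᵐ x ∂μ, x ∈ U → L.apply Φ x = 0) {α : ℝ} (hα : α ≠ 1)
    (hf : IsTest m U f) :
    ∫ x, Φ x ^ α * (L.Gamma Φ Φ x / Φ x ^ 2) * f x ^ 2 ∂μ ≤
      (2 / (α - 1)) ^ 2 * ∫ x, Φ x ^ α * L.Gamma f f x ∂μ := by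
  have hrpow (γ : ℝ) : ∀ x ∈ U, SmoothNear m (fun y => Φ y ^ γ) x := fun x hx =>
    (hΦ x hx).comp (θ := fun z => z ^ γ) <| by
      filter_upwards [lt_mem_nhds (hpos x hx)] with z hz
      exact Real.contDiffAt_rpow_const_of_ne hz.ne'
  have hff : IsTest m U fun x => f x * f x := hf.mul_smooth fun x _ => hf.smoothNear x
  -- Testing `L Φ = 0` against this function produces the vanishing integral `hG0`.
  have hφ : IsTest m U fun x => f x * f x * Φ x ^ (α - 1) := hff.mul_smooth (hrpow _)
  have hff0 : ∀ x, x ∉ U → f x = 0 := fun x hx =>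
    image_eq_zero_of_notMem_tsupport fun h => hx (hf.2.2 h)
  have hJ : IsTest m U fun x => Φ x ^ α * (L.Gamma Φ Φ x / Φ x ^ 2) * f x ^ 2 := by
    refine isTest_of_eq_zero hf (fun x hx => ?_) fun x hx => by
      simp [image_eq_zero_of_notMem_tsupport hx]
    have := ((hrpow (α - 2) x hx).mul ((hL x hx).Gamma (hΦ x hx) (hΦ x hx))).mul
      (hff.smoothNear x)
    refine this.congr ?_
    filter_upwards [hU.mem_nhds hx] with y hy
    rw [Real.rpow_sub (hpos y hy), Real.rpow_two]
    ring
  have hI : IsTest m U fun x => Φ x ^ α * L.Gamma f f x :=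
    isTest_of_eq_zero hf (fun x hx => (hrpow α x hx).mul
      ((hL x hx).Gamma (hf.smoothNear x) (hf.smoothNear x))) fun x hx => by
      simp [L.Gamma_eq_zero (eventuallyEq_zero_of_notMem_tsupport hx)]
  have hG : IsTest m U (L.Gamma (fun x => f x * f x * Φ x ^ (α - 1)) Φ) := hφ.Gamma hL hΦ
  have hG0 : ∫ x, L.Gamma (fun x => f x * f x * Φ x ^ (α - 1)) Φ x ∂μ = 0 := by
    have h1 := (h.integral_mul_apply_of_smooth hU hφ hΦ).1
    have h2 : ∫ x, f x * f x * Φ x ^ (α - 1) * L.apply Φ x ∂μ = 0 := by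
      refine integral_eq_zero_of_ae ?_
      filter_upwards [hharm] with x hx
      by_cases hxU : x ∈ U
      · simp [hx hxU]
      · simp [hff0 x hxU]
    linarith
  -- This `β` solves `β (α - 1) + β² = -β²`, which matches the coefficients of `Γ(Φ)` in `key`.
  -- Formally `f = Φ^β` is the equality case.
  set β : ℝ := (1 - α) / 2 with hβ
  have key : ∀ x, β * L.Gamma (fun x => f x * f x * Φ x ^ (α - 1)) Φ x +
      β ^ 2 * (Φ x ^ α * (L.Gamma Φ Φ x / Φ x ^ 2) * f x ^ 2) ≤ Φ x ^ α * L.Gamma f f x := by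
    intro x
    by_cases hxU : x ∈ U
    · have hp := hpos x hxU
      have hr := hrpow (α - 1) x hxU
      have hfx := hf.smoothNear x
      have hΦx := hΦ x hxU
      have hd : HasDerivAt (fun z : ℝ => z ^ (α - 1)) ((α - 1) * Φ x ^ (α - 1 - 1)) (Φ x) :=
        Real.hasDerivAt_rpow_const (Or.inl hp.ne')
      rw [L.Gamma_comm, L.Gamma_mul (hff.smoothNear x) hr hΦx ((hff.smoothNear x).mul hr),
        L.Gamma_mul hfx hfx hΦx (hff.smoothNear x), L.Gamma_comp hd hΦx hΦx hr]
      have h1 := L.two_mul_Gamma_le hfx hΦx (β * f x / Φ x)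
      have h2 := mul_le_mul_of_nonneg_left h1 (Real.rpow_nonneg hp.le α)
      refine le_trans (le_of_eq ?_) h2
      rw [L.Gamma_comm Φ f, Real.rpow_sub hp, Real.rpow_sub hp, Real.rpow_one, hβ]
      field_simp
      ring
    · have hx : x ∉ tsupport f := fun h => hxU (hf.2.2 h)
      have hx' : x ∉ tsupport fun x => f x * f x * Φ x ^ (α - 1) := fun h => hxU (hφ.2.2 h)
      simp [L.Gamma_eq_zero (eventuallyEq_zero_of_notMem_tsupport hx),
        L.Gamma_eq_zero (eventuallyEq_zero_of_notMem_tsupport hx'), hff0 x hxU]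
  have hint := integral_mono (((IsTest.integrable h.1 hG).const_mul β).add
    ((IsTest.integrable h.1 hJ).const_mul (β ^ 2))) (IsTest.integrable h.1 hI) key
  have hsplit := integral_add ((IsTest.integrable h.1 hG).const_mul β)
    ((IsTest.integrable h.1 hJ).const_mul (β ^ 2))
  simp only [Pi.add_apply] at hint
  rw [hsplit, integral_const_mul, integral_const_mul, hG0, mul_zero, zero_add] at hint
  have hc : (2 / (α - 1)) ^ 2 * β ^ 2 = 1 := by
    have : α - 1 ≠ 0 := sub_ne_zero.2 hα
    rw [hβ]; field_simp; ring
  have := mul_le_mul_of_nonneg_left hint (sq_nonneg (2 / (α - 1)))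
  rwa [← mul_assoc, hc, one_mul] at this

end Reversible

/-! ### Pairings of integrable and square integrable functions. -/

section LTwo

variable {X : Type*} [MeasurableSpace X] {μ : Measure X}

theorem inner_eq_integral_mul (F G : Lp ℝ 2 μ) : inner ℝ F G = ∫ x, F x * G x ∂μ := by
  rw [L2.inner_def]
  exact integral_congr_ae (Eventually.of_forall fun x => by simp [mul_comm])

/-- Multiplication by a bounded measurable function, as an operator on `L²`. -/
theorem exists_mul_clm {w : X → ℝ} (hw : AEStronglyMeasurable w μ) {C : ℝ} (hC : ∀ x, |w x| ≤ C) :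
    ∃ M : Lp ℝ 2 μ →L[ℝ] Lp ℝ 2 μ, ∀ F, M F =ᵐ[μ] fun x => w x * F x := by
  have hw' : MemLp w ⊤ μ := memLp_top_of_bound hw C (Eventually.of_forall hC)
  refine ⟨(ContinuousLinearMap.mul ℝ ℝ).holderL μ ⊤ 2 2 (hw'.toLp w), fun F => ?_⟩
  have h := ContinuousLinearMap.coeFn_holder (r := 2) (ContinuousLinearMap.mul ℝ ℝ : ℝ →L[ℝ] ℝ →L[ℝ] ℝ) (hw'.toLp w) F
  filter_upwards [h, hw'.coeFn_toLp] with x hx hx'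
  simp [ContinuousLinearMap.holderL_apply_apply, hx, hx']

theorem integrable_mul_of_abs_le {u φ : X → ℝ} (hu : Integrable u μ) (hφ : AEStronglyMeasurable φ μ)
    {C : ℝ} (hC : ∀ᵐ x ∂μ, |φ x| ≤ C) : Integrable (fun x => u x * φ x) μ :=
  hu.mul_bdd hφ hC

theorem abs_integral_mul_le {u φ : X → ℝ} (hu : Integrable u μ) {C : ℝ}
    (hC : ∀ᵐ x ∂μ, |φ x| ≤ C) : |∫ x, u x * φ x ∂μ| ≤ (∫ x, |u x| ∂μ) * C := by
  rw [← integral_mul_const]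
  rw [← Real.norm_eq_abs]
  refine norm_integral_le_of_norm_le (hu.abs.mul_const C) ?_
  filter_upwards [hC] with x hx
  rw [Real.norm_eq_abs, abs_mul]
  exact mul_le_mul_of_nonneg_left hx (abs_nonneg _)

/-- Approximation of an integrable function in `L¹` by square integrable functions. -/
theorem exists_lTwo_approx {u : X → ℝ} (hu : Integrable u μ) :
    ∃ w : ℕ → Lp ℝ 2 μ, (∀ k, Integrable (w k) μ) ∧
      Tendsto (fun k => ∫ x, |u x - w k x| ∂μ) atTop (𝓝 0) := by
  obtain ⟨v, hv, huv⟩ := hu.1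
  have hvi : Integrable v μ := hu.congr huv
  have hS (k : ℕ) : MeasurableSet {x | |v x| ≤ k} :=
    measurableSet_le hv.measurable.abs measurable_const
  have hint (k : ℕ) : Integrable ({x | |v x| ≤ k}.indicator v) μ := hvi.indicator (hS k)
  have hL2 (k : ℕ) : MemLp ({x | |v x| ≤ k}.indicator v) 2 μ := by
    rw [memLp_two_iff_integrable_sq (hint k).1]
    refine ((hint k).norm.const_mul (k : ℝ)).mono' ((hint k).1.pow 2) (Eventually.of_forall ?_)
    intro x
    have hb : |{x | |v x| ≤ k}.indicator v x| ≤ k := by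
      by_cases hx : |v x| ≤ k <;> simp [Set.indicator, hx]
    simp only [Real.norm_eq_abs, abs_mul, sq]
    exact mul_le_mul_of_nonneg_right hb (abs_nonneg _)
  refine ⟨fun k => (hL2 k).toLp _, fun k => (hint k).congr (hL2 k).coeFn_toLp.symm, ?_⟩
  have h0 : ∫ _, (0 : ℝ) ∂μ = 0 := by simp
  rw [← h0]
  have hae (k : ℕ) : (fun x => |u x - (hL2 k).toLp _ x|) =ᵐ[μ]
      fun x => |v x - {x | |v x| ≤ k}.indicator v x| := by
    filter_upwards [huv, (hL2 k).coeFn_toLp] with x h1 h2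
    rw [h1, h2]
  simp_rw [fun k => integral_congr_ae (hae k)]
  refine tendsto_integral_of_dominated_convergence (fun x => |v x|)
    (fun k => (hvi.sub (hint k)).abs.1) hvi.abs (fun k => Eventually.of_forall fun x => ?_)
    (Eventually.of_forall fun x => ?_)
  · by_cases hx : |v x| ≤ k <;> simp [Set.indicator, hx]
  · obtain ⟨n, hn⟩ := exists_nat_ge |v x|
    refine tendsto_const_nhds.congr' ?_
    filter_upwards [eventually_ge_atTop n] with k hk
    have : |v x| ≤ k := hn.trans (by exact_mod_cast hk)
    simp [Set.indicator, this]

/-- The error depends on `φ` only through its bound, and `P_s` preserves that bound. Semigroup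
identities in `L²` therefore pass to an integrable `u` uniformly in `s`. -/
theorem abs_integral_mul_sub_inner_le {u : X → ℝ} (hu : Integrable u μ) {w : Lp ℝ 2 μ}
    (hw : Integrable w μ) {φ : Lp ℝ 2 μ} {C : ℝ} (hC : ∀ᵐ x ∂μ, |φ x| ≤ C) :
    |∫ x, u x * φ x ∂μ - inner ℝ w φ| ≤ (∫ x, |u x - w x| ∂μ) * C := by
  rw [inner_eq_integral_mul, ← integral_sub (integrable_mul_of_abs_le hu (Lp.aestronglyMeasurable φ) hC)
    (integrable_mul_of_abs_le hw (Lp.aestronglyMeasurable φ) hC)]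
  simp_rw [← sub_mul]
  exact abs_integral_mul_le (hu.sub hw) hC

theorem l2Class_eq {f : X → ℝ} (hf : MemLp f 2 μ) : l2Class μ f =ᵐ[μ] f := by
  rw [l2Class, dif_pos hf]
  exact hf.coeFn_toLp

end LTwo

/-! ### Order, continuity and differentiation of the semigroup. -/

namespace IsSymmetricSubMarkovSemigroup

variable {X : Type*} [MeasurableSpace X] {μ : Measure X} {P : ℝ → Lp ℝ 2 μ →L[ℝ] Lp ℝ 2 μ}
  {t : ℝ} {F G F' G' : Lp ℝ 2 μ}

theorem le_of_le (hP : IsSymmetricSubMarkovSemigroup μ P)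
    (ht : 0 ≤ t) {C : ℝ} (hC : 0 < C) (hF : ∀ᵐ x ∂μ, F x ≤ C) :
    ∀ᵐ x ∂μ, P t F x ≤ C := by
  have h := hP.subMarkov t ht (C⁻¹ • F) <| by
    filter_upwards [hF, Lp.coeFn_smul C⁻¹ F] with x hx h'
    rw [h', Pi.smul_apply, smul_eq_mul, inv_mul_le_iff₀ hC, mul_one]
    exact hx
  rw [map_smul] at h
  filter_upwards [h, Lp.coeFn_smul C⁻¹ (P t F)] with x hx h'
  rwa [h', Pi.smul_apply, smul_eq_mul, inv_mul_le_iff₀ hC, mul_one] at hx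

theorem abs_le_of_abs_le (hP : IsSymmetricSubMarkovSemigroup μ P)
    (ht : 0 ≤ t) {C : ℝ} (hC : 0 < C) (hF : ∀ᵐ x ∂μ, |F x| ≤ C) :
    ∀ᵐ x ∂μ, |P t F x| ≤ C := by
  have h1 := hP.le_of_le ht hC (hF.mono fun x hx => (abs_le.1 hx).2)
  have h2 := hP.le_of_le (F := -F) ht hC <| by
    filter_upwards [hF, Lp.coeFn_neg F] with x hx h'
    rw [h', Pi.neg_apply]
    linarith [(abs_le.1 hx).1]
  rw [map_neg] at h2
  filter_upwards [h1, h2, Lp.coeFn_neg (P t F)] with x hx hx' h'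
  rw [h', Pi.neg_apply] at hx'
  exact abs_le.2 ⟨by linarith, hx⟩

/-- If `F ≥ 0` then `-F ≤ ε` for each `ε > 0`, a level that `P_t` preserves; let `ε = 1 / (n + 1)`
tend to zero. -/
theorem nonneg_of_nonneg (hP : IsSymmetricSubMarkovSemigroup μ P)
    (ht : 0 ≤ t) (hF : ∀ᵐ x ∂μ, 0 ≤ F x) : ∀ᵐ x ∂μ, 0 ≤ P t F x := by
  have h : ∀ n : ℕ, ∀ᵐ x ∂μ, (P t (-F)) x ≤ 1 / ((n : ℝ) + 1) := fun n =>
    hP.le_of_le ht (by positivity) <| by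
      filter_upwards [hF, Lp.coeFn_neg F] with x hx h'
      rw [h', Pi.neg_apply]
      have : 0 < 1 / ((n : ℝ) + 1) := by positivity
      linarith
  rw [map_neg] at h
  filter_upwards [ae_all_iff.2 h, Lp.coeFn_neg (P t F)] with x hx h'
  rw [h', Pi.neg_apply] at hx
  have := ge_of_tendsto' tendsto_one_div_add_atTop_nhds_zero_nat hx
  linarith

theorem mono_of_le (hP : IsSymmetricSubMarkovSemigroup μ P)
    (ht : 0 ≤ t) (h : ∀ᵐ x ∂μ, F x ≤ G x) : ∀ᵐ x ∂μ, P t F x ≤ P t G x := by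
  have h1 := hP.nonneg_of_nonneg (F := G - F) ht <| by
    filter_upwards [h, Lp.coeFn_sub G F] with x hx h'
    rw [h', Pi.sub_apply]; linarith
  rw [map_sub] at h1
  filter_upwards [h1, Lp.coeFn_sub (P t G) (P t F)] with x hx h'
  rw [h', Pi.sub_apply] at hx
  linarith

/-- Contractivity reduces both one-sided limits at `t` to strong continuity at zero, through `‖P_t F
- P_s F‖ ≤ ‖P_|t-s| F - F‖`. -/
theorem continuousOn (hP : IsSymmetricSubMarkovSemigroup μ P)
    (F : Lp ℝ 2 μ) : ContinuousOn (fun t => P t F) (Set.Ici 0) := by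
  have hle : ∀ s t : ℝ, 0 ≤ s → s ≤ t → ‖P t F - P s F‖ ≤ ‖P (t - s) F - F‖ := by
    intro s t hs hst
    have h := hP.add s (t - s) hs (sub_nonneg.2 hst)
    rw [add_sub_cancel] at h
    rw [h, ContinuousLinearMap.comp_apply, ← map_sub]
    exact hP.contraction s hs _
  have hlim : Tendsto (fun t => ‖P t F - F‖) (𝓝[≥] 0) (𝓝 0) := by
    have h0 : ContinuousWithinAt (fun t => P t F) (Set.Ioi 0) 0 := by
      simpa [ContinuousWithinAt, hP.zero] using hP.tendsto_zero F
    have := continuousWithinAt_Ioi_iff_Ici.1 h0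
    rw [ContinuousWithinAt, hP.zero] at this
    simpa using (this.sub_const F).norm
  intro t ht
  rw [Set.mem_Ici] at ht
  rw [ContinuousWithinAt, tendsto_iff_norm_sub_tendsto_zero]
  have habs : Tendsto (fun s : ℝ => |s - t|) (𝓝[Set.Ici 0] t) (𝓝[≥] 0) := by
    refine tendsto_nhdsWithin_iff.2 ⟨?_, Eventually.of_forall fun s => Set.mem_Ici.2 (abs_nonneg _)⟩
    have : Tendsto (fun s : ℝ => |s - t|) (𝓝 t) (𝓝 |t - t|) :=
      (continuous_sub_right t).abs.tendsto t
    rw [sub_self, abs_zero] at this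
    exact this.mono_left nhdsWithin_le_nhds
  refine squeeze_zero' (Eventually.of_forall fun _ => norm_nonneg _) ?_ (hlim.comp habs)
  filter_upwards [self_mem_nhdsWithin] with s hs
  rw [Set.mem_Ici] at hs
  rcases le_total t s with h | h
  · simpa [abs_of_nonneg (sub_nonneg.2 h)] using hle t s ht h
  · rw [norm_sub_rev]
    simpa [abs_of_nonpos (sub_nonpos.2 h)] using hle s t hs h

/-- `P_t F` is differentiable from the right in `t` if `F` is in the domain of the generator. -/
theorem hasDerivWithinAt (hP : IsSymmetricSubMarkovSemigroup μ P)
    (ht : 0 ≤ t)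
    (hF : Tendsto (fun s : ℝ => s⁻¹ • (P s F - F)) (𝓝[>] 0) (𝓝 F')) :
    HasDerivWithinAt (fun s => P s F) (P t F') (Set.Ioi t) t := by
  rw [hasDerivWithinAt_iff_tendsto_slope' Set.self_notMem_Ioi]
  have hmap : Tendsto (fun s : ℝ => s - t) (𝓝[>] t) (𝓝[>] 0) := by
    refine tendsto_nhdsWithin_iff.2 ⟨?_, ?_⟩
    · have : Tendsto (fun s : ℝ => s - t) (𝓝 t) (𝓝 (t - t)) := (continuous_sub_right t).tendsto t
      rw [sub_self] at this
      exact this.mono_left nhdsWithin_le_nhds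
    · filter_upwards [self_mem_nhdsWithin] with s hs using sub_pos.2 (Set.mem_Ioi.1 hs)
  refine (((P t).continuous.tendsto F').comp (hF.comp hmap)).congr' ?_
  filter_upwards [self_mem_nhdsWithin] with s hs
  have h := hP.add t (s - t) ht (sub_nonneg.2 (le_of_lt hs))
  rw [add_sub_cancel] at h
  simp [slope_def_module, h]

theorem integral_inner_eq (hP : IsSymmetricSubMarkovSemigroup μ P) (w : Lp ℝ 2 μ) (ht : 0 ≤ t)
    (hF : Tendsto (fun s : ℝ => s⁻¹ • (P s F - F)) (𝓝[>] 0) (𝓝 F')) :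
    ∫ s in (0 : ℝ)..t, inner ℝ w (P s F') = inner ℝ w (P t F - F) := by
  have hc (K : Lp ℝ 2 μ) : ContinuousOn (fun s => inner ℝ w (P s K)) (Set.Icc 0 t) :=
    continuousOn_const.inner ((hP.continuousOn K).mono Set.Icc_subset_Ici_self)
  rw [intervalIntegral.integral_eq_sub_of_hasDeriv_right_of_le ht (hc F) (f' := fun s => inner ℝ w (P s F'))
    (fun s hs => ?_) ((hc F').intervalIntegrable_of_Icc ht), hP.zero, inner_sub_right]
  · rfl
  · simpa using (hasDerivWithinAt_const s _ w).inner ℝ (hP.hasDerivWithinAt hs.1.le hF)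

/-- The generator is symmetric. -/
theorem inner_apply_generator (hP : IsSymmetricSubMarkovSemigroup μ P)
    (ht : 0 ≤ t)
    (hF : Tendsto (fun s : ℝ => s⁻¹ • (P s F - F)) (𝓝[>] 0) (𝓝 F'))
    (hG : Tendsto (fun s : ℝ => s⁻¹ • (P s G - G)) (𝓝[>] 0) (𝓝 G')) :
    inner ℝ (P t F') G = inner ℝ (P t F) G' := by
  have h1 : Tendsto (fun s : ℝ => inner ℝ (P t (s⁻¹ • (P s F - F))) G) (𝓝[>] 0)
      (𝓝 (inner ℝ (P t F') G)) := (((P t).continuous.tendsto F').comp hF).inner tendsto_const_nhds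
  have h2 : Tendsto (fun s : ℝ => inner ℝ (P t F) (s⁻¹ • (P s G - G))) (𝓝[>] 0)
      (𝓝 (inner ℝ (P t F) G')) := tendsto_const_nhds.inner hG
  -- For each `s > 0` the two difference quotients agree, as `P_s` is self-adjoint and commutes with
  -- `P_t`.
  refine tendsto_nhds_unique (h1.congr' ?_) h2
  filter_upwards [self_mem_nhdsWithin] with s hs
  have hs : 0 ≤ s := le_of_lt hs
  have hcomm : P t (P s F) = P s (P t F) := by
    rw [← ContinuousLinearMap.comp_apply, ← ContinuousLinearMap.comp_apply, ← hP.add t s ht hs,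
      ← hP.add s t hs ht, add_comm]
  rw [map_smul, map_sub, hcomm, real_inner_smul_left, real_inner_smul_right, inner_sub_left,
    inner_sub_right, hP.symm s hs]

theorem continuousOn_integral_mul (hP : IsSymmetricSubMarkovSemigroup μ P)
    {u : X → ℝ} (hu : Integrable u μ) {C : ℝ} (hC : 0 < C)
    (hF : ∀ᵐ x ∂μ, |F x| ≤ C) : ContinuousOn (fun s => ∫ x, u x * P s F x ∂μ) (Set.Ici 0) := by
  obtain ⟨w, hw, hlim⟩ := exists_lTwo_approx hu
  have hunif : TendstoUniformlyOn (fun k s => inner ℝ (w k) (P s F))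
      (fun s => ∫ x, u x * P s F x ∂μ) atTop (Set.Ici 0) := by
    rw [Metric.tendstoUniformlyOn_iff]
    intro ε hε
    have h0 := hlim.mul_const C
    rw [zero_mul] at h0
    filter_upwards [h0.eventually (gt_mem_nhds hε)] with k hk s hs
    rw [Real.dist_eq]
    exact (abs_integral_mul_sub_inner_le hu (hw k) (hP.abs_le_of_abs_le hs hC hF)).trans_lt hk
  exact hunif.continuousOn (Frequently.of_forall fun k =>
    continuousOn_const.inner (hP.continuousOn F))

/-- `P_t F - F = ∫₀ᵗ P_s A F ds`, tested against an integrable function. -/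
theorem integral_mul_sub_eq (hP : IsSymmetricSubMarkovSemigroup μ P)
    {u : X → ℝ} (hu : Integrable u μ) (ht : 0 ≤ t)
    {C : ℝ} (hC : 0 < C) (hF : ∀ᵐ x ∂μ, |F x| ≤ C) (hF' : ∀ᵐ x ∂μ, |F' x| ≤ C)
    (hFF' : Tendsto (fun s : ℝ => s⁻¹ • (P s F - F)) (𝓝[>] 0) (𝓝 F')) :
    ∫ x, u x * P t F x ∂μ - ∫ x, u x * F x ∂μ = ∫ s in (0 : ℝ)..t, ∫ x, u x * P s F' x ∂μ := by
  obtain ⟨w, hw, hlim⟩ := exists_lTwo_approx hu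
  have hcont := (hP.continuousOn_integral_mul hu hC hF').mono (Set.Icc_subset_Ici_self : Set.Icc 0 t ⊆ _)
  have hl0 (D : ℝ) : Tendsto (fun k => (∫ x, |u x - w k x| ∂μ) * D) atTop (𝓝 0) := by
    simpa using hlim.mul_const D
  have h1 : Tendsto (fun k => inner ℝ (w k) (P t F - F)) atTop
      (𝓝 (∫ x, u x * P t F x ∂μ - ∫ x, u x * F x ∂μ)) := by
    simp_rw [inner_sub_right]
    refine Tendsto.sub ?_ ?_
    · refine tendsto_iff_norm_sub_tendsto_zero.2 (squeeze_zero (fun _ => norm_nonneg _)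
        (fun k => ?_) (hl0 C))
      rw [norm_sub_rev]
      exact abs_integral_mul_sub_inner_le hu (hw k) (hP.abs_le_of_abs_le ht hC hF)
    · refine tendsto_iff_norm_sub_tendsto_zero.2 (squeeze_zero (fun _ => norm_nonneg _)
        (fun k => ?_) (hl0 C))
      rw [norm_sub_rev]
      exact abs_integral_mul_sub_inner_le hu (hw k) hF
  have h2 : Tendsto (fun k => inner ℝ (w k) (P t F - F)) atTop
      (𝓝 (∫ s in (0 : ℝ)..t, ∫ x, u x * P s F' x ∂μ)) := by
    refine tendsto_iff_norm_sub_tendsto_zero.2 (squeeze_zero (fun _ => norm_nonneg _)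
      (fun k => ?_) (by simpa using hl0 (C * |t - 0|)))
    have hc : ContinuousOn (fun s => inner ℝ (w k) (P s F')) (Set.Icc 0 t) :=
      continuousOn_const.inner ((hP.continuousOn F').mono Set.Icc_subset_Ici_self)
    rw [← hP.integral_inner_eq (w k) ht hFF', ← intervalIntegral.integral_sub
      (hc.intervalIntegrable_of_Icc ht) (hcont.intervalIntegrable_of_Icc ht)]
    refine (intervalIntegral.norm_integral_le_of_norm_le_const
      (C := (∫ x, |u x - w k x| ∂μ) * C) fun s hs => ?_).trans_eq (by simp [mul_assoc])
    rw [Set.uIoc_of_le ht] at hs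
    rw [norm_sub_rev]
    exact abs_integral_mul_sub_inner_le hu (hw k) (hP.abs_le_of_abs_le hs.1.le hC hF')
  exact tendsto_nhds_unique h1 h2

/-- The derivative of a weighted energy along the semigroup, in integrated form. -/
theorem integral_weighted_sq (hP : IsSymmetricSubMarkovSemigroup μ P)
    {w : X → ℝ} (hw : AEStronglyMeasurable w μ) {C : ℝ}
    (hC : ∀ x, |w x| ≤ C) (ht : 0 ≤ t)
    (hF : Tendsto (fun s : ℝ => s⁻¹ • (P s F - F)) (𝓝[>] 0) (𝓝 F')) :
    ContinuousOn (fun s => ∫ x, w x * P s F x * P s F' x ∂μ) (Set.Icc 0 t) ∧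
    ∫ x, w x * P t F x * P t F x ∂μ - ∫ x, w x * F x * F x ∂μ =
      ∫ s in (0 : ℝ)..t, 2 * ∫ x, w x * P s F x * P s F' x ∂μ := by
  obtain ⟨M, hM⟩ := exists_mul_clm hw hC
  have hMi (K K' : Lp ℝ 2 μ) : inner ℝ (M K) K' = ∫ x, w x * K x * K' x ∂μ := by
    rw [inner_eq_integral_mul]
    refine integral_congr_ae ?_
    filter_upwards [hM K] with x hx
    rw [hx]
  have hMc (K K' : Lp ℝ 2 μ) : inner ℝ (M K) K' = inner ℝ (M K') K := by
    rw [hMi, hMi]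
    exact integral_congr_ae (Eventually.of_forall fun x => by ring)
  have hc (K K' : Lp ℝ 2 μ) : ContinuousOn (fun s => inner ℝ (M (P s K)) (P s K')) (Set.Icc 0 t) :=
    (M.continuous.comp_continuousOn ((hP.continuousOn K).mono Set.Icc_subset_Ici_self)).inner
      ((hP.continuousOn K').mono Set.Icc_subset_Ici_self)
  refine ⟨by simpa only [hMi] using hc F F', ?_⟩
  have hd := intervalIntegral.integral_eq_sub_of_hasDeriv_right_of_le ht (hc F F)
    (f' := fun s => 2 * inner ℝ (M (P s F)) (P s F')) (fun s hs => ?_)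
    (((hc F F').const_smul (2 : ℝ)).intervalIntegrable_of_Icc ht)
  · simp only [hMi, hP.zero] at hd
    rw [hd]; rfl
  · have h := hP.hasDerivWithinAt hs.1.le hF
    have hMd : HasDerivWithinAt (fun s => M (P s F)) (M (P s F')) (Set.Ioi s) s :=
      M.hasFDerivAt.comp_hasDerivWithinAt s h
    have := hMd.inner ℝ h
    rw [hMc (P s F')] at this
    rw [two_mul]
    exact this

end IsSymmetricSubMarkovSemigroup

/-- A weighted `L²` contraction from an upper bound of the derivative of the weighted energy. -/
theorem IsSymmetricSubMarkovSemigroup.integral_weighted_sq_le {X : Type*} [MeasurableSpace X]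
    {μ : Measure X} {P : ℝ → Lp ℝ 2 μ →L[ℝ] Lp ℝ 2 μ} (hP : IsSymmetricSubMarkovSemigroup μ P)
    {w : X → ℝ} (hw : AEStronglyMeasurable w μ) (hw0 : ∀ᵐ x ∂μ, 0 < w x) {b : ℝ} (hb : 0 < b)
    {F F' : Lp ℝ 2 μ} (hF : Tendsto (fun s : ℝ => s⁻¹ • (P s F - F)) (𝓝[>] 0) (𝓝 F'))
    {k : ℝ → X → ℝ} (hk : ∀ r, 0 < r → Integrable (k r) μ)
    (hle : ∀ r, 0 < r → ∀ᵐ x ∂μ, 2 * (w x * P r F x * P r F' x) ≤ k r x)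
    (hk0 : ∀ r, 0 < r → ∫ x, k r x ∂μ ≤ 0)
    (hkint : IntervalIntegrable (fun r => ∫ x, |k r x| ∂μ) volume 0 b)
    (h0 : Integrable (fun x => w x * F x * F x) μ)
    (h1 : Integrable (fun x => w x * P b F x * P b F x) μ) :
    ∫ x, w x * P b F x * P b F x ∂μ ≤ ∫ x, w x * F x * F x ∂μ := by
  -- Truncated weights are bounded, so `integral_weighted_sq` applies. The maximum with zero is
  -- there because `w` is positive only almost everywhere.
  set v : ℕ → X → ℝ := fun n x => max (min (w x) n) 0 with hv
  have hvm (n : ℕ) : AEStronglyMeasurable (v n) μ :=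
    (hw.inf aestronglyMeasurable_const).sup aestronglyMeasurable_const
  have hvn (n : ℕ) (x : X) : |v n x| ≤ n := by
    rw [abs_of_nonneg (le_max_right _ _)]
    exact max_le (min_le_right _ _) n.cast_nonneg
  have hv0 (n : ℕ) (x : X) : 0 ≤ v n x := le_max_right _ _
  have hvw (n : ℕ) {x : X} (hx : 0 < w x) : v n x ≤ w x := max_le (min_le_left _ _) hx.le
  have hvlim {x : X} (hx : 0 < w x) : ∀ᶠ n in atTop, v n x = w x := by
    obtain ⟨N, hN⟩ := exists_nat_ge (w x)
    filter_upwards [eventually_ge_atTop N] with n hn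
    have : w x ≤ n := hN.trans (by exact_mod_cast hn)
    simp [hv, this, hx.le]
  have henergy (K : Lp ℝ 2 μ) (hK : Integrable (fun x => w x * K x * K x) μ) :
      Tendsto (fun n => ∫ x, v n x * K x * K x ∂μ) atTop (𝓝 (∫ x, w x * K x * K x ∂μ)) := by
    refine tendsto_integral_of_dominated_convergence (fun x => w x * K x * K x)
      (fun n => ((hvm n).mul (Lp.aestronglyMeasurable K)).mul (Lp.aestronglyMeasurable K)) hK
      (fun n => ?_) ?_
    · filter_upwards [hw0] with x hx
      rw [mul_assoc, mul_assoc, Real.norm_of_nonneg (mul_nonneg (hv0 n x) (mul_self_nonneg _))]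
      exact mul_le_mul_of_nonneg_right (hvw n hx) (mul_self_nonneg _)
    · filter_upwards [hw0] with x hx
      refine tendsto_const_nhds.congr' ?_
      filter_upwards [hvlim hx] with n hn
      rw [hn]
  set e : ℕ → ℝ → ℝ := fun n r => 2 * ∫ x, v n x * P r F x * P r F' x ∂μ with he
  have hs (n : ℕ) := hP.integral_weighted_sq (hvm n) (hvn n) hb.le hF
  have hec (n : ℕ) : ContinuousOn (e n) (Set.Icc 0 b) := continuousOn_const.mul (hs n).1
  -- Multiplying the bound `hle` by `θ = v / w`, which lies in `[0, 1]`, turns the weight `w` into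
  -- `v`; integrability is needed only for `k` and for the truncated product.
  set θ : ℕ → X → ℝ := fun n x => v n x / w x with hθ
  have hθm (n : ℕ) : AEStronglyMeasurable (θ n) μ :=
    ((hvm n).aemeasurable.div hw.aemeasurable).aestronglyMeasurable
  have hθ1 (n : ℕ) {x : X} (hx : 0 < w x) : 0 ≤ θ n x ∧ θ n x ≤ 1 :=
    ⟨div_nonneg (hv0 n x) hx.le, (div_le_one hx).2 (hvw n hx)⟩
  have hθabs (n : ℕ) (r : ℝ) : ∀ᵐ x ∂μ, ‖θ n x * k r x‖ ≤ |k r x| := by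
    filter_upwards [hw0] with x hx
    rw [norm_mul, Real.norm_of_nonneg (hθ1 n hx).1]
    exact mul_le_of_le_one_left (abs_nonneg _) (hθ1 n hx).2
  have hθk (n : ℕ) {r : ℝ} (hr : 0 < r) : Integrable (fun x => θ n x * k r x) μ :=
    (hk r hr).abs.mono' ((hθm n).mul (hk r hr).1) (hθabs n r)
  have hele (n : ℕ) {r : ℝ} (hr : 0 < r) : e n r ≤ ∫ x, θ n x * k r x ∂μ := by
    simp only [he]
    rw [← integral_const_mul]
    refine integral_mono_ae ?_ (hθk n hr) ?_
    · have := ((Lp.memLp (P r F)).integrable_mul (Lp.memLp (P r F'))).bdd_mul (hvm n)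
        (Eventually.of_forall (hvn n))
      refine (this.const_mul 2).congr (Eventually.of_forall fun x => ?_)
      simp [mul_assoc]
    · filter_upwards [hw0, hle r hr] with x hx h
      have h2 := mul_le_mul_of_nonneg_left h (hθ1 n hx).1
      refine le_trans (le_of_eq ?_) h2
      simp only [hθ]
      field_simp
  have hθlim {r : ℝ} (hr : 0 < r) : Tendsto (fun n => ∫ x, θ n x * k r x ∂μ) atTop
      (𝓝 (∫ x, k r x ∂μ)) := by
    refine tendsto_integral_of_dominated_convergence (fun x => |k r x|)
      (fun n => (hθk n hr).1) (hk r hr).abs (fun n => hθabs n r) ?_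
    filter_upwards [hw0] with x hx
    refine tendsto_const_nhds.congr' ?_
    filter_upwards [hvlim hx] with n hn
    simp [hθ, hn, hx.ne']
  -- The derivatives `e n` are controlled only from above, so dominated convergence is applied to
  -- their positive parts.
  have hlim : Tendsto (fun n => ∫ r in (0 : ℝ)..b, max (e n r) 0) atTop (𝓝 0) := by
    have hz : ∫ _ in (0 : ℝ)..b, (0 : ℝ) = 0 := by simp
    suffices h : Tendsto (fun n => ∫ r in (0 : ℝ)..b, max (e n r) 0) atTop
        (𝓝 (∫ _ in (0 : ℝ)..b, (0 : ℝ))) by rwa [hz] at h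
    refine intervalIntegral.tendsto_integral_filter_of_dominated_convergence
      (fun r => ∫ x, |k r x| ∂μ) (Eventually.of_forall fun n => ?_)
      (Eventually.of_forall fun n => Eventually.of_forall fun r hr => ?_) hkint
      (Eventually.of_forall fun r hr => ?_)
    · rw [Set.uIoc_of_le hb.le]
      exact (((hec n).mono Set.Ioc_subset_Icc_self).sup continuousOn_const).aestronglyMeasurable
        measurableSet_Ioc
    · rw [Set.uIoc_of_le hb.le] at hr
      rw [Real.norm_of_nonneg (le_max_right _ _)]
      refine max_le ((hele n hr.1).trans ?_) (integral_nonneg fun x => abs_nonneg _)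
      exact (le_abs_self _).trans (norm_integral_le_of_norm_le (hk r hr.1).abs (hθabs n r))
    · rw [Set.uIoc_of_le hb.le] at hr
      have hm := (hθlim hr.1).max (tendsto_const_nhds (x := (0 : ℝ)))
      rw [max_eq_right (hk0 r hr.1)] at hm
      exact squeeze_zero (fun n => le_max_right _ _) (fun n => max_le_max_right _ (hele n hr.1)) hm
  refine sub_nonpos.1 (le_of_tendsto_of_tendsto' ((henergy _ h1).sub (henergy _ h0)) hlim
    fun n => ?_)
  rw [(hs n).2]
  exact intervalIntegral.integral_mono_on hb.le ((hec n).intervalIntegrable_of_Icc hb.le)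
    (((hec n).sup continuousOn_const).intervalIntegrable_of_Icc hb.le) fun r _ => le_max_left _ _

/-- An open set is `σ`-compact here; the complements of an exhausting sequence decrease to the null
set `Uᶜ`. -/
theorem exists_isCompact_setIntegral_compl_lt {X : Type*} [TopologicalSpace X] [LocallyCompactSpace X]
    [T2Space X] [SecondCountableTopology X] [MeasurableSpace X] [BorelSpace X] {μ : Measure X}
    {U : Set X} {k : X → ℝ} (hU : IsOpen U) (hμU : ∀ᵐ x ∂μ, x ∈ U) (hk : Integrable k μ) {ε : ℝ} (hε : 0 < ε) :
    ∃ K, IsCompact K ∧ K ⊆ U ∧ ∫ x in Kᶜ, |k x| ∂μ < ε := by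
  have : LocallyCompactSpace U := hU.locallyCompactSpace
  have : SigmaCompactSpace U := inferInstance
  set K : ℕ → Set X := fun n => Subtype.val '' compactCovering U n with hK
  have hKc (n : ℕ) : IsCompact (K n) := (isCompact_compactCovering U n).image continuous_subtype_val
  have hKU (n : ℕ) : K n ⊆ U := by rintro _ ⟨y, -, rfl⟩; exact y.2
  have hanti : Antitone fun n => (K n)ᶜ := fun a b hab =>
    Set.compl_subset_compl.2 (Set.image_mono (compactCovering_subset U hab))
  have hlim := hanti.tendsto_setIntegral (fun n => (hKc n).measurableSet.compl)
    (hk.abs.integrableOn (s := (K 0)ᶜ))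
  have hU' : ⋂ n, (K n)ᶜ = Uᶜ := by
    rw [← Set.compl_iUnion, hK, ← Set.image_iUnion, iUnion_compactCovering, Set.image_univ,
      Subtype.range_coe]
  have h0 : μ Uᶜ = 0 := hμU
  rw [hU', Measure.restrict_eq_zero.2 h0, integral_zero_measure] at hlim
  obtain ⟨n, hn⟩ := (hlim.eventually (gt_mem_nhds hε)).exists
  exact ⟨K n, hKc n, hKU n, hn⟩

theorem integral_abs_mul_one_sub_le {X : Type*} [MeasurableSpace X] {μ : Measure X} {k : X → ℝ}
    (hk : Integrable k μ) {K : Set X} (hK : MeasurableSet K)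
    {χ : X → ℝ} (h1 : ∀ x ∈ K, χ x = 1) (h01 : ∀ x, 0 ≤ χ x ∧ χ x ≤ 1) :
    ∫ x, |k x| * (1 - χ x) ∂μ ≤ ∫ x in Kᶜ, |k x| ∂μ := by
  rw [← integral_indicator hK.compl]
  refine integral_mono_of_nonneg (Eventually.of_forall fun x =>
    mul_nonneg (abs_nonneg _) (sub_nonneg.2 (h01 x).2)) (hk.abs.indicator hK.compl)
    (Eventually.of_forall fun x => ?_)
  by_cases hx : x ∈ K
  · simp [h1 x hx, hx]
  · simp only [Set.indicator_of_mem (Set.mem_compl hx)]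
    exact mul_le_of_le_one_right (abs_nonneg _) (by linarith [(h01 x).1])

/-! ### Consequences of commutation, and the heat equation for smooth versions. -/

section Manifold

variable {m : ℕ} {X : Type*} [TopologicalSpace X] [ChartedSpace (EuclideanSpace ℝ (Fin m)) X]
  [MeasurableSpace X] [BorelSpace X] {μ : Measure X} {L : DiffusionOperator m X} {U V : Set X}
  {f g φ k u W : X → ℝ}

theorem AESmooth.aestronglyMeasurable [SecondCountableTopology X] (hf : AESmooth m μ f) :
    AEStronglyMeasurable f μ := by
  have hc : ContinuousOn f {x | SmoothNear m f x} := fun x hx =>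
    (SmoothNear.continuousAt hx).continuousWithinAt
  have := hc.aestronglyMeasurable (μ := μ) (isOpen_setOf_smoothNear f).measurableSet
  rwa [Measure.restrict_eq_self_of_ae_mem (s := {x | SmoothNear m f x}) hf] at this

variable [T2Space X] [SecondCountableTopology X] [IsManifold (𝓡 m) ∞ X]
  {P : ℝ → Lp ℝ 2 μ →L[ℝ] Lp ℝ 2 μ}

/-- If `u ≥ 0` and `L P_s u = P_s k` for all `s > 0` then `∫ k ≤ 0`: the semigroup does not
increase the mass of `u`. -/
theorem integral_nonpos_of_commutes (hP : IsSymmetricSubMarkovSemigroup μ P)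
    (hPL : L.Generates μ U P) (hrev : L.IsReversible μ U) (hU : IsOpen U)
    (hL : ∀ x ∈ U, L.SmoothNear x) (hμU : ∀ᵐ x ∂μ, x ∈ U) (hu : Integrable u μ)
    (hk : Integrable k μ) (hu0 : ∀ x, 0 ≤ u x)
    (hcomm : ∀ s : ℝ, 0 < s → ∀ φ, IsTest m U φ →
      ∫ x, u x * P s (l2Class μ (L.apply φ)) x ∂μ = ∫ x, k x * P s (l2Class μ φ) x ∂μ) :
    ∫ x, k x ∂μ ≤ 0 := by
  have : LocallyCompactSpace X := ChartedSpace.locallyCompactSpace (EuclideanSpace ℝ (Fin m)) X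
  -- For a cutoff `χ` close to 1 and small `s`, `∫ u P_s χ` has derivative `∫ k P_s χ`, close to
  -- `c`. If `c > 0` it would outgrow `∫ u`, against `P_s χ ≤ 1`.
  by_contra! hc
  set c := ∫ x, k x ∂μ with hcdef
  have hcl {φ : X → ℝ} (hφ : IsTest m U φ) : l2Class μ φ =ᵐ[μ] φ :=
    l2Class_eq (hφ.memLp_two hrev.1)
  have hle1 {φ : X → ℝ} (hφ : IsTest m U φ) (h01 : ∀ x, 0 ≤ φ x ∧ φ x ≤ 1) :
      ∀ᵐ x ∂μ, |l2Class μ φ x| ≤ 1 := by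
    filter_upwards [hcl hφ] with x hx
    rw [hx, abs_of_nonneg (h01 x).1]
    exact (h01 x).2
  have hint {h : X → ℝ} (hh : Integrable h μ) {φ : X → ℝ} (hφ : IsTest m U φ)
      (h01 : ∀ x, 0 ≤ φ x ∧ φ x ≤ 1) {s : ℝ} (hs : 0 ≤ s) :
      Integrable (fun x => h x * P s (l2Class μ φ) x) μ :=
    integrable_mul_of_abs_le hh (Lp.aestronglyMeasurable _)
      (hP.abs_le_of_abs_le hs one_pos (hle1 hφ h01))
  -- Two cutoffs are needed. `χ₀`, adapted to `k`, fixes the time span `δ`; then `χ ≥ χ₀`, adapted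
  -- to `u`, has an error that is small compared with `δ`.
  obtain ⟨K₀, hK₀, hK₀U, hK₀k⟩ := exists_isCompact_setIntegral_compl_lt hU hμU hk
    (show 0 < c / 4 by linarith)
  obtain ⟨χ₀, hχ₀, hχ₀1, hχ₀01⟩ := exists_isTest_eq_one (m := m) hU hK₀ hK₀U
  have hρ := hP.continuousOn_integral_mul hk.abs one_pos (hle1 hχ₀ hχ₀01)
  have hρ0 : ∫ x, |k x| ∂μ - c / 2 < ∫ x, |k x| * P 0 (l2Class μ χ₀) x ∂μ := by
    have e : ∫ x, |k x| * P 0 (l2Class μ χ₀) x ∂μ = ∫ x, |k x| * χ₀ x ∂μ := by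
      refine integral_congr_ae ?_
      filter_upwards [hcl hχ₀] with x hx
      simp [hP.zero, hx]
    have hi : Integrable (fun x => |k x| * χ₀ x) μ :=
      integrable_mul_of_abs_le hk.abs hχ₀.1.continuous.aestronglyMeasurable
        (C := 1) (Eventually.of_forall fun x => by
          rw [abs_of_nonneg (hχ₀01 x).1]; exact (hχ₀01 x).2)
    have h := integral_abs_mul_one_sub_le hk hK₀.measurableSet
      (fun x hx => (hχ₀1 x hx).self_of_nhds) hχ₀01
    simp_rw [mul_sub, mul_one] at h
    rw [integral_sub hk.abs hi] at h
    rw [e]; linarith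
  obtain ⟨δ, hδ, hδρ⟩ := mem_nhdsGE_iff_exists_Icc_subset.1
    ((hρ 0 Set.self_mem_Ici).eventually (lt_mem_nhds hρ0))
  obtain ⟨K₁, hK₁, hK₁U, hK₁u⟩ := exists_isCompact_setIntegral_compl_lt hU hμU hu
    (show 0 < δ * (c / 4) by positivity)
  obtain ⟨χ, hχ, hχ1, hχ01⟩ := exists_isTest_eq_one (m := m) hU (hK₁.union hχ₀.2.1)
    (Set.union_subset hK₁U hχ₀.2.2)
  have hχ₀χ : ∀ x, χ₀ x ≤ χ x := fun x => by
    by_cases hx : x ∈ tsupport χ₀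
    · rw [(hχ1 x (Or.inr hx)).self_of_nhds]; exact (hχ₀01 x).2
    · rw [image_eq_zero_of_notMem_tsupport hx]; exact (hχ01 x).1
  have hlow : ∀ s ∈ Set.Icc 0 δ, c / 2 ≤ ∫ x, k x * P s (l2Class μ χ) x ∂μ := by
    intro s hs
    have h1 : ∫ x, |k x| ∂μ - c / 2 < ∫ x, |k x| * P s (l2Class μ χ₀) x ∂μ := hδρ hs
    have hm := hP.mono_of_le hs.1 (F := l2Class μ χ₀) (G := l2Class μ χ) <| by
      filter_upwards [hcl hχ₀, hcl hχ] with x h h'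
      rw [h, h']; exact hχ₀χ x
    have hb := hP.abs_le_of_abs_le hs.1 one_pos (hle1 hχ hχ01)
    have hks : Integrable (fun x => k x - |k x|) μ := hk.sub hk.abs
    -- From `k ≤ |k|` and `P_s χ ≤ 1` follows `k P_s χ ≥ k - |k| + |k| P_s χ`; in the last term
    -- monotonicity replaces `χ` by `χ₀`.
    have h2 : ∫ x, (k x - |k x| + |k x| * P s (l2Class μ χ₀) x) ∂μ ≤
        ∫ x, k x * P s (l2Class μ χ) x ∂μ := by
      refine integral_mono_ae (hks.add (hint hk.abs hχ₀ hχ₀01 hs.1))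
        (hint hk hχ hχ01 hs.1) ?_
      filter_upwards [hm, hb] with x h3 h4
      have h5 := mul_le_mul_of_nonneg_right (le_abs_self (k x)) (sub_nonneg.2 (abs_le.1 h4).2)
      have h6 := mul_le_mul_of_nonneg_left h3 (abs_nonneg (k x))
      linarith
    rw [integral_add hks (hint hk.abs hχ₀ hχ₀01 hs.1), integral_sub hk hk.abs] at h2
    linarith
  obtain ⟨C, hC⟩ := (hχ.apply hL).exists_bound
  have hD : 0 < max C 1 := lt_max_of_lt_right one_pos
  have hFD : ∀ᵐ x ∂μ, |l2Class μ χ x| ≤ max C 1 :=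
    (hle1 hχ hχ01).mono fun x hx => hx.trans (le_max_right _ _)
  have hFD' : ∀ᵐ x ∂μ, |l2Class μ (L.apply χ) x| ≤ max C 1 := by
    filter_upwards [hcl (hχ.apply hL)] with x hx
    rw [hx]; exact (hC x).trans (le_max_left _ _)
  have hftc := hP.integral_mul_sub_eq hu hδ.le hD hFD hFD' (hPL χ hχ)
  have hge : δ * (c / 2) ≤ ∫ s in (0 : ℝ)..δ, ∫ x, u x * P s (l2Class μ (L.apply χ)) x ∂μ := by
    have hcont := (hP.continuousOn_integral_mul hu hD hFD').mono
      (Set.Icc_subset_Ici_self : Set.Icc 0 δ ⊆ _)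
    -- The open interval matters: commutation is only given for `s > 0`.
    have := intervalIntegral.integral_mono_on_of_le_Ioo hδ.le
      (intervalIntegrable_const (μ := volume) (c := c / 2)) (hcont.intervalIntegrable_of_Icc hδ.le)
      fun s hs => (hlow s ⟨hs.1.le, hs.2.le⟩).trans_eq (hcomm s hs.1 χ hχ).symm
    simpa [mul_div_assoc] using this
  have hup : ∫ x, u x * P δ (l2Class μ χ) x ∂μ - ∫ x, u x * l2Class μ χ x ∂μ < δ * (c / 4) := by
    refine lt_of_le_of_lt ?_ ((integral_abs_mul_one_sub_le hu hK₁.measurableSet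
      (fun x hx => (hχ1 x (Or.inl hx)).self_of_nhds) hχ01).trans_lt hK₁u)
    have hi : Integrable (fun x => u x * l2Class μ χ x) μ :=
      integrable_mul_of_abs_le hu (Lp.aestronglyMeasurable _) (hle1 hχ hχ01)
    have hi' : Integrable (fun x => |u x| * (1 - χ x)) μ :=
      integrable_mul_of_abs_le hu.abs
        (continuous_const.sub hχ.1.continuous).aestronglyMeasurable (C := 1)
        (Eventually.of_forall fun x => by
          rw [abs_of_nonneg (sub_nonneg.2 (hχ01 x).2)]; linarith [(hχ01 x).1])
    rw [← integral_sub (hint hu hχ hχ01 hδ.le) hi]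
    refine integral_mono_ae ((hint hu hχ hχ01 hδ.le).sub hi) hi' ?_
    filter_upwards [hP.abs_le_of_abs_le hδ.le one_pos (hle1 hχ hχ01), hcl hχ] with x h h'
    rw [h', abs_of_nonneg (hu0 x), ← mul_sub]
    exact mul_le_mul_of_nonneg_left (by linarith [(abs_le.1 h).2]) (hu0 x)
  have : 0 < δ * c := mul_pos hδ hc
  linarith

/-- A smooth version of `P_t f` solves the heat equation almost everywhere. -/
theorem apply_version_eq (hP : IsSymmetricSubMarkovSemigroup μ P)
    (hPL : L.Generates μ U P) (hrev : L.IsReversible μ U) (hU : IsOpen U)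
    (hL : ∀ x ∈ U, L.SmoothNear x) (hμU : ∀ᵐ x ∂μ, x ∈ U) (hf : IsTest m U f)
    {t : ℝ} (ht : 0 ≤ t) (hg : g =ᵐ[μ] P t (l2Class μ f)) (hgs : AESmooth m μ g) :
    L.apply g =ᵐ[μ] P t (l2Class μ (L.apply f)) := by
  -- On `V`, where `g` is smooth too, `∫ φ L g = ∫ g L φ`. Symmetry of the generator turns this into
  -- `∫ φ P_t L f`, and varying the test function `φ` identifies `L g`.
  set V := U ∩ {x | SmoothNear m g x} with hV
  have hVo : IsOpen V := hU.inter (isOpen_setOf_smoothNear g)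
  have hVU : V ⊆ U := Set.inter_subset_left
  have hμV : ∀ᵐ x ∂μ, x ∈ V := by filter_upwards [hμU, hgs] with x h1 h2 using ⟨h1, h2⟩
  have hgV : ∀ x ∈ V, SmoothNear m g x := fun x hx => hx.2
  have hrevV := hrev.mono hVU
  have : LocallyCompactSpace X := ChartedSpace.locallyCompactSpace (EuclideanSpace ℝ (Fin m)) X
  have hi1 {χ : X → ℝ} (hχ : IsTest m V χ) : Integrable (fun x => χ x * L.apply g x) μ :=
    IsTest.integrable hrevV.1 (hχ.mul_smooth fun x hx => (hL x (hVU hx)).apply (hgV x hx))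
  have hi2 {χ : X → ℝ} (hχ : IsTest m V χ) :
      Integrable (fun x => χ x * P t (l2Class μ (L.apply f)) x) μ :=
    (hχ.memLp_two hrevV.1).integrable_mul (Lp.memLp _)
  have hloc : LocallyIntegrableOn (fun x => L.apply g x - P t (l2Class μ (L.apply f)) x) V μ := by
    rw [locallyIntegrableOn_iff hVo.isLocallyClosed]
    intro K hKV hK
    obtain ⟨χ, hχ, hχ1, -⟩ := exists_isTest_eq_one (m := m) hVo hK hKV
    refine ((hi1 hχ).sub (hi2 hχ)).integrableOn.congr_fun (fun x hx => ?_) hK.measurableSet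
    simp [(hχ1 x hx).self_of_nhds]
  have h0 := hVo.ae_eq_zero_of_integral_contMDiff_smul_eq_zero (𝓡 m) hloc fun φ h1 h2 h3 => by
    have hφ : IsTest m V φ := ⟨h1, h2, h3⟩
    have hφU := hφ.mono hVU
    have hsymm := hP.inner_apply_generator ht (hPL f hf) (hPL φ hφU)
    rw [inner_eq_integral_mul, inner_eq_integral_mul] at hsymm
    have e1 : ∫ x, P t (l2Class μ (L.apply f)) x * l2Class μ φ x ∂μ =
        ∫ x, φ x * P t (l2Class μ (L.apply f)) x ∂μ := by
      refine integral_congr_ae ?_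
      filter_upwards [l2Class_eq (hφU.memLp_two hrev.1)] with x hx
      rw [hx, mul_comm]
    have e2 : ∫ x, P t (l2Class μ f) x * l2Class μ (L.apply φ) x ∂μ =
        ∫ x, g x * L.apply φ x ∂μ := by
      refine integral_congr_ae ?_
      filter_upwards [l2Class_eq ((hφU.apply hL).memLp_two hrev.1), hg] with x hx hx'
      rw [hx, hx']
    have e3 := (hrevV.integral_mul_apply_of_smooth hVo hφ hgV).2
    simp only [smul_eq_mul, mul_sub]
    rw [integral_sub (hi1 hφ) (hi2 hφ), ← e1, hsymm, e2, e3, sub_self]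
  filter_upwards [h0, hμV] with x hx hxV
  exact sub_eq_zero.1 (hx hxV)

end Manifold

/-- Subharmonicity of `g² / Φ` along the heat flow, for a positive `L`-harmonic function `Φ`. -/
theorem two_mul_le_apply_weighted_sq {m : ℕ} {X : Type*} [TopologicalSpace X]
    [ChartedSpace (EuclideanSpace ℝ (Fin m)) X] {L : DiffusionOperator m X} {W Φ g : X → ℝ} {x : X}
    (hW : SmoothNear m W x) (hΦ : SmoothNear m Φ x) (hg : SmoothNear m g x)
    (hpos : 0 < Φ x) (hWΦ : ∀ᶠ y in 𝓝 x, Φ y * W y ^ 2 = 1) (hharm : L.apply Φ x = 0) :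
    2 * (W x ^ 2 * g x * L.apply g x) ≤ L.apply (fun y => W y ^ 2 * g y ^ 2) x := by
  -- Near `x` this `h` is `g / Φ`, so `g = Φ h` and the weighted square is `Φ h²`. The two sides
  -- then differ by `2 Φ Γ(h)`.
  obtain ⟨h, hh⟩ : ∃ h : X → ℝ, h = fun y => W y * W y * g y := ⟨_, rfl⟩
  have hhs : SmoothNear m h x := hh ▸ (hW.mul hW).mul hg
  have hhh : SmoothNear m (fun y => h y * h y) x := hhs.mul hhs
  have e1 : (fun y => W y ^ 2 * g y ^ 2) =ᶠ[𝓝 x] fun y => Φ y * (h y * h y) := by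
    filter_upwards [hWΦ] with y hy
    simp only [hh]
    linear_combination (-(W y ^ 2 * g y ^ 2)) * hy
  have e2 : g =ᶠ[𝓝 x] fun y => Φ y * h y := by
    filter_upwards [hWΦ] with y hy
    simp only [hh]
    linear_combination (-(g y)) * hy
  have hx := hWΦ.self_of_nhds
  rw [L.apply_congr e1, L.apply_congr e2, L.apply_mul_eq_add_Gamma, L.apply_mul_eq_add_Gamma,
    L.apply_mul_eq_add_Gamma, L.Gamma_mul hhs hhs hΦ hhh, hharm]
  have hn := mul_nonneg hpos.le (L.Gamma_self_nonneg hhs)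
  have e3 : W x ^ 2 * g x = h x := by simp only [hh]; ring
  rw [e3]
  linarith

/-! ### Harmonicity of `log ψ`, and `Φ` on the regular set. -/

section Log

variable {m : ℕ} {X : Type*} [TopologicalSpace X] [ChartedSpace (EuclideanSpace ℝ (Fin m)) X]
  {L : DiffusionOperator m X} {ψ Φ W : X → ℝ} {x : X}

theorem DiffusionOperator.Gamma_neg_neg (L : DiffusionOperator m X) (f g : X → ℝ) (x : X) :
    L.Gamma (fun y => -f y) (fun y => -g y) x = L.Gamma f g x := by
  simp only [Gamma, neg_mul_neg, L.apply_neg]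

/-- If `L ψ = Γ(ψ) / ψ` then `log ψ` is `L`-harmonic, and `Γ(ψ) = ψ² Γ(log ψ)`. -/
theorem apply_log_eq_zero (hs : SmoothNear m (fun y => Real.log (ψ y)) x)
    (hpos : ∀ᶠ y in 𝓝 x, 0 < ψ y) (hlap : L.apply ψ x = (2 - 1) / ψ x * L.Gamma ψ ψ x) :
    L.apply (fun y => Real.log (ψ y)) x = 0 ∧
      L.Gamma ψ ψ x = ψ x ^ 2 * L.Gamma (fun y => Real.log (ψ y)) (fun y => Real.log (ψ y)) x := by
  obtain ⟨l, hl⟩ : ∃ l : X → ℝ, l = fun y => Real.log (ψ y) := ⟨_, rfl⟩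
  rw [← hl] at hs ⊢
  have hx := hpos.self_of_nhds
  -- With `ψ = exp l` one has `L ψ = ψ (L l + Γ(l))` and `Γ(ψ) = ψ² Γ(l)`; for `Q = 2` the terms in
  -- `Γ(l)` cancel.
  have he : ψ =ᶠ[𝓝 x] fun y => Real.exp (l y) := by
    filter_upwards [hpos] with y hy
    rw [hl, Real.exp_log hy]
  have hsexp : SmoothNear m (fun y => Real.exp (l y)) x :=
    hs.comp (Eventually.of_forall fun z => Real.contDiff_exp.contDiffAt)
  have hd := Real.hasDerivAt_exp (l x)
  have hG : L.Gamma ψ ψ x = ψ x ^ 2 * L.Gamma l l x := by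
    rw [L.Gamma_congr he he, L.Gamma_comp hd hs hsexp hsexp, L.Gamma_comm,
      L.Gamma_comp hd hs hs hsexp, he.self_of_nhds]
    ring
  refine ⟨?_, hG⟩
  have hex : ψ x = Real.exp (l x) := he.self_of_nhds
  rw [hG, L.apply_congr he, L.apply_exp hs, ← hex] at hlap
  field_simp at hlap
  linarith

theorem mul_rpow_neg_half_sq {a : ℝ} (ha : 0 < a) : a * (a ^ (-(1 / 2) : ℝ)) ^ 2 = 1 := by
  rw [← Real.rpow_natCast, ← Real.rpow_mul ha.le]
  norm_num
  rw [Real.rpow_neg_one, mul_inv_cancel₀ ha.ne']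

theorem inv_rpow_neg_half_mul_self {a : ℝ} (ha : 0 ≤ a) :
    (a ^ (-(1 / 2) : ℝ))⁻¹ * (a ^ (-(1 / 2) : ℝ))⁻¹ = a := by
  rw [Real.rpow_neg ha, inv_inv, ← Real.sqrt_eq_rpow, Real.mul_self_sqrt ha]

/-- A zero of `Φ` would be a zero of `W`, because `0 ^ (-(1 / 2)) = 0` by convention. -/
theorem regularSet_pos (hΦ0 : ∀ x, 0 ≤ Φ x) (hW : ∀ x, W x = Φ x ^ (-(1 / 2) : ℝ))
    (hx : x ∈ L.regularSet W) : 0 < Φ x := by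
  refine (hΦ0 x).lt_of_ne fun h => ?_
  have := hx.2.2.2.1
  rw [hW, ← h, Real.zero_rpow (by norm_num)] at this
  exact lt_irrefl _ this

/-- `Φ` is the square of `W⁻¹` everywhere, its zeros included by the conventions for powers and
inverses of zero. -/
theorem regularSet_smoothNear (hΦ0 : ∀ x, 0 ≤ Φ x) (hW : ∀ x, W x = Φ x ^ (-(1 / 2) : ℝ))
    (hx : x ∈ L.regularSet W) : SmoothNear m Φ x := by
  refine (hx.2.2.1.mul hx.2.2.1).congr (Eventually.of_forall fun y => ?_)
  simp only [hW, inv_rpow_neg_half_mul_self (hΦ0 y)]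

theorem ae_mem_regularSet [MeasurableSpace X] {μ : Measure X} (hL : ∀ᵐ x ∂μ, L.SmoothNear x)
    (hW : AESmooth m μ W) (hW0 : ∀ᵐ x ∂μ, 0 < W x) : ∀ᵐ x ∂μ, x ∈ L.regularSet W := by
  filter_upwards [hL, hW, hW0] with x h1 h2 h3
  refine ⟨h1, h2, h2.comp (θ := fun z => z⁻¹) ?_, h3, inv_pos.2 h3⟩
  filter_upwards [lt_mem_nhds h3] with z hz
  exact contDiffAt_inv ℝ hz.ne'

end Log

theorem eLpNorm_two_le_of_integral_sq_le {X : Type*} [MeasurableSpace X] {μ : Measure X}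
    {f g : X → ℝ} (hf : MemLp f 2 μ) (hg : MemLp g 2 μ)
    (h : ∫ x, f x ^ 2 ∂μ ≤ ∫ x, g x ^ 2 ∂μ) : eLpNorm f 2 μ ≤ eLpNorm g 2 μ := by
  rw [hf.eLpNorm_eq_integral_rpow_norm two_ne_zero ENNReal.ofNat_ne_top,
    hg.eLpNorm_eq_integral_rpow_norm two_ne_zero ENNReal.ofNat_ne_top]
  refine ENNReal.ofReal_le_ofReal (Real.rpow_le_rpow (integral_nonneg fun x => by positivity) ?_
    (by positivity))
  simpa using h

/-! ### The weighted contraction and the theorem. -/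

section Main

variable {m : ℕ} {X : Type*} [TopologicalSpace X] [T2Space X] [SecondCountableTopology X]
  [ChartedSpace (EuclideanSpace ℝ (Fin m)) X] [IsManifold (𝓡 m) ∞ X] [MeasurableSpace X]
  [BorelSpace X] {μ : Measure X} {L : DiffusionOperator m X} {ψ Φ W f : X → ℝ}
  {P : ℝ → Lp ℝ 2 μ →L[ℝ] Lp ℝ 2 μ}

/-- The semigroup contracts the `L²` norm with weight `Φ⁻¹`, for a positive harmonic `Φ`. -/
theorem eLpNorm_weighted_semigroup_le (hL : ∀ᵐ x ∂μ, L.SmoothNear x) (hΦ0 : ∀ x, 0 ≤ Φ x)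
    (hΦ_pos : ∀ᵐ x ∂μ, 0 < Φ x) (hW_eq : ∀ x, W x = Φ x ^ (-(1 / 2) : ℝ)) (hW : AESmooth m μ W)
    (hharm : ∀ᵐ x ∂μ, x ∈ L.regularSet W → L.apply Φ x = 0)
    (hμ : L.IsReversible μ (L.regularSet W)) (hP : IsSymmetricSubMarkovSemigroup μ P)
    (hPL : L.Generates μ (L.regularSet W) P) (hf : L.MemA0 μ P W f) {t : ℝ} (ht : 0 ≤ t) :
    eLpNorm (fun x => Φ x ^ (-(1 / 2) : ℝ) * P t (l2Class μ f) x) 2 μ ≤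
      eLpNorm (fun x => Φ x ^ (-(1 / 2) : ℝ) * f x) 2 μ := by
  obtain ⟨hft, g, hg, hgs, hcomm, hN⟩ := hf
  simp_rw [← hW_eq]
  have hUo := L.isOpen_regularSet W
  have hLU : ∀ x ∈ L.regularSet W, L.SmoothNear x := fun x hx => hx.1
  have hW0 : ∀ᵐ x ∂μ, 0 < W x := by
    filter_upwards [hΦ_pos] with x hx
    rw [hW_eq]; exact Real.rpow_pos_of_pos hx _
  have hμU := ae_mem_regularSet hL hW hW0
  have hfc := l2Class_eq (hft.memLp_two hμ.1)
  have hWm : AEStronglyMeasurable W μ := hW.aestronglyMeasurable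
  have hWf : MemLp (fun x => W x * f x) 2 μ := by
    refine ((hft.mul_smooth fun x hx => hx.2.1).memLp_two hμ.1).ae_eq
      (Eventually.of_forall fun x => mul_comm _ _)
  -- Smooth versions and commutation are only given at positive times.
  rcases ht.eq_or_lt with rfl | ht
  · refine le_of_eq (eLpNorm_congr_ae ?_)
    filter_upwards [hfc] with x hx
    simp [hP.zero, hx]
  have hu (r : ℝ) (hr : 0 < r) : Integrable (fun x => W x ^ 2 * g r x ^ 2) μ ∧
      Integrable (L.apply fun x => W x ^ 2 * g r x ^ 2) μ := by
    obtain ⟨p, q, h1, h2, -⟩ := hcomm 1 r one_pos hr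
    exact ⟨h1.1, h2.1⟩
  have hneg (r : ℝ) (hr : 0 < r) : ∫ x, L.apply (fun y => W y ^ 2 * g r y ^ 2) x ∂μ ≤ 0 := by
    refine integral_nonpos_of_commutes hP hPL hμ hUo hLU hμU (hu r hr).1 (hu r hr).2
      (fun x => by positivity) fun s hs φ hφ => ?_
    -- Duality moves `P_s` from `u` and `L u` onto the bounded test functions `L φ` and `φ`.
    obtain ⟨p, q, ⟨-, -, hp⟩, ⟨-, -, hq⟩, hpq⟩ := hcomm s r hs hr
    have hb {χ : X → ℝ} (hχ : IsTest m (L.regularSet W) χ) :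
        ∃ C : ℝ, ∀ᵐ x ∂μ, |l2Class μ χ x| ≤ C := by
      obtain ⟨C, hC⟩ := hχ.exists_bound
      refine ⟨C, ?_⟩
      filter_upwards [l2Class_eq (hχ.memLp_two hμ.1)] with x hx
      rw [hx]; exact hC x
    have hae (v : X → ℝ) {χ : X → ℝ} (hχ : IsTest m (L.regularSet W) χ) :
        ∫ x, v x * l2Class μ χ x ∂μ = ∫ x, v x * χ x ∂μ := by
      refine integral_congr_ae ?_
      filter_upwards [l2Class_eq (hχ.memLp_two hμ.1)] with x hx
      rw [hx]
    have hLφ := hφ.apply hLU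
    rw [← hp _ (hb hLφ), ← hq _ (hb hφ), hae p hLφ, hae q hφ, hpq φ hφ]
  have hle (r : ℝ) (hr : 0 < r) : ∀ᵐ x ∂μ,
      2 * (W x ^ 2 * P r (l2Class μ f) x * P r (l2Class μ (L.apply f)) x) ≤
        L.apply (fun y => W y ^ 2 * g r y ^ 2) x := by
    filter_upwards [hμU, hharm, hg r hr, hgs r hr,
      apply_version_eq hP hPL hμ hUo hLU hμU hft hr.le (hg r hr) (hgs r hr)] with x h1 h2 h3 h4 h5
    rw [← h3, ← h5]
    refine two_mul_le_apply_weighted_sq h1.2.1 (regularSet_smoothNear hΦ0 hW_eq h1) h4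
      (regularSet_pos hΦ0 hW_eq h1) ?_ (h2 h1)
    filter_upwards [hUo.mem_nhds h1] with y hy
    rw [hW_eq, mul_rpow_neg_half_sq (regularSet_pos hΦ0 hW_eq hy)]
  have hE0 : (fun x => W x ^ 2 * l2Class μ f x * l2Class μ f x) =ᵐ[μ] fun x => (W x * f x) ^ 2 := by
    filter_upwards [hfc] with x hx
    rw [hx]; ring
  have hE1 : (fun x => W x ^ 2 * P t (l2Class μ f) x * P t (l2Class μ f) x) =ᵐ[μ]
      fun x => W x ^ 2 * g t x ^ 2 := by
    filter_upwards [hg t ht] with x hx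
    rw [hx]; ring
  have hE1' : (fun x => W x ^ 2 * P t (l2Class μ f) x * P t (l2Class μ f) x) =
      fun x => (W x * P t (l2Class μ f) x) ^ 2 := by
    funext x; ring
  have hi1 := (hu t ht).1.congr hE1.symm
  have hmain := hP.integral_weighted_sq_le (hWm.pow 2) (hW0.mono fun x hx => pow_pos hx 2) ht
    (hPL f hft) (fun r hr => (hu r hr).2) hle hneg (hN t ht)
    (hWf.integrable_sq.congr hE0.symm) hi1
  simp only [Pi.pow_apply] at hmain
  rw [integral_congr_ae hE0, hE1'] at hmain
  rw [hE1'] at hi1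
  exact eLpNorm_two_le_of_integral_sq_le ((memLp_two_iff_integrable_sq
    (hWm.mul (Lp.aestronglyMeasurable _))).2 hi1) hWf hmain

end Main

end LogHardy

theorem mainTheorem4 {m : ℕ} {X : Type*} [TopologicalSpace X] [T2Space X]
    [SecondCountableTopology X] [ChartedSpace (EuclideanSpace ℝ (Fin m)) X]
    [IsManifold (𝓡 m) ∞ X] [MeasurableSpace X] [BorelSpace X] (μ : Measure X)
    (L : LogHardy.DiffusionOperator m X) (ψ Φ W : X → ℝ)
    (hL : ∀ᵐ x ∂μ, L.SmoothNear x)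
    (hψ_nonneg : ∀ x, 0 ≤ ψ x) (hψ : LogHardy.AESmooth m μ ψ)
    (hψ_lap : L.LaplacianIdentity μ 2 ψ)
    (hΦ : (∀ x, ψ x ≤ 1 ∧ Φ x = -Real.log (ψ x)) ∨ (∀ x, 1 ≤ ψ x ∧ Φ x = Real.log (ψ x)))
    (hΦ_pos : ∀ᵐ x ∂μ, 0 < Φ x)
    (hW_eq : ∀ x, W x = Φ x ^ (-(1 / 2) : ℝ)) (hW : LogHardy.AESmooth m μ W)
    (hμ : L.IsReversible μ (L.regularSet W))
    (P : ℝ → Lp ℝ 2 μ →L[ℝ] Lp ℝ 2 μ)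
    (hP : LogHardy.IsSymmetricSubMarkovSemigroup μ P)
    (hPL : L.Generates μ (L.regularSet W) P) :
    ((∀ f : X → ℝ, L.MemA0 μ P W f → ∀ t : ℝ, 0 ≤ t →
        eLpNorm (fun x => Φ x ^ (-(1 / 2) : ℝ) * P t (LogHardy.l2Class μ f) x) 2 μ
          ≤ eLpNorm (fun x => Φ x ^ (-(1 / 2) : ℝ) * f x) 2 μ) ↔
      (∀ f : X → ℝ, L.MemA0 μ P W f →
        ∫ x, L.Gamma ψ ψ x / (ψ x ^ 2 * Real.log (ψ x) ^ 2) * f x ^ 2 ∂μ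
          ≤ 4 * ∫ x, L.Gamma f f x ∂μ)) ∧
    ∀ α : ℝ, α ≠ 1 →
      ((∀ f : X → ℝ, L.MemA0 μ P W f →
        ∫ x, L.Gamma ψ ψ x / (ψ x ^ 2 * Real.log (ψ x) ^ 2) * f x ^ 2 ∂μ
          ≤ 4 * ∫ x, L.Gamma f f x ∂μ) ↔
      (∀ f : X → ℝ, L.MemA0 μ P W f →
        ∫ x, |Real.log (ψ x)| ^ α * (L.Gamma ψ ψ x / (ψ x ^ 2 * Real.log (ψ x) ^ 2)) * f x ^ 2 ∂μ
          ≤ (2 / (α - 1)) ^ 2 * ∫ x, |Real.log (ψ x)| ^ α * L.Gamma f f x ∂μ)) := by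
  have habs : ∀ x, |Real.log (ψ x)| = Φ x := by
    intro x
    rcases hΦ with h | h
    · rw [(h x).2, abs_of_nonpos (Real.log_nonpos (hψ_nonneg x) (h x).1)]
    · rw [(h x).2, abs_of_nonneg (Real.log_nonneg (h x).1)]
  have hΦ0 : ∀ x, 0 ≤ Φ x := fun x => habs x ▸ abs_nonneg _
  have hUo := L.isOpen_regularSet W
  have hW0 : ∀ᵐ x ∂μ, 0 < W x := by
    filter_upwards [hΦ_pos] with x hx
    rw [hW_eq]; exact Real.rpow_pos_of_pos hx _
  have hμU := LogHardy.ae_mem_regularSet hL hW hW0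
  have hpos : ∀ x ∈ L.regularSet W, 0 < Φ x := fun x hx => LogHardy.regularSet_pos hΦ0 hW_eq hx
  have hsm : ∀ x ∈ L.regularSet W, LogHardy.SmoothNear m Φ x :=
    fun x hx => LogHardy.regularSet_smoothNear hΦ0 hW_eq hx
  -- Since `Real.log 0 = 0`, a zero of `ψ` would be a zero of `Φ`.
  have hψpos : ∀ x ∈ L.regularSet W, 0 < ψ x := fun x hx => by
    refine (hψ_nonneg x).lt_of_ne fun h => (hpos x hx).ne' ?_
    rw [← habs, ← h, Real.log_zero, abs_zero]
  have hcalc : ∀ᵐ x ∂μ, x ∈ L.regularSet W →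
      L.apply Φ x = 0 ∧ L.Gamma ψ ψ x = ψ x ^ 2 * L.Gamma Φ Φ x := by
    filter_upwards [hψ_lap] with x hx hxU
    have hψnear : ∀ᶠ y in 𝓝 x, 0 < ψ y := by
      filter_upwards [hUo.mem_nhds hxU] with y hy using hψpos y hy
    rcases hΦ with h | h
    · have e : Φ = fun y => -Real.log (ψ y) := funext fun y => (h y).2
      have e' : (fun y => Real.log (ψ y)) = fun y => -Φ y := funext fun y => by rw [(h y).2, neg_neg]
      have hl : LogHardy.SmoothNear m (fun y => Real.log (ψ y)) x := e' ▸ (hsm x hxU).neg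
      obtain ⟨h1, h2⟩ := LogHardy.apply_log_eq_zero hl hψnear hx
      rw [e, L.apply_neg, h1, L.Gamma_neg_neg]
      exact ⟨neg_zero, h2⟩
    · have e : Φ = fun y => Real.log (ψ y) := funext fun y => (h y).2
      rw [e]
      exact LogHardy.apply_log_eq_zero (e ▸ hsm x hxU) hψnear hx
  have hharm : ∀ᵐ x ∂μ, x ∈ L.regularSet W → L.apply Φ x = 0 :=
    hcalc.mono fun x hx hxU => (hx hxU).1
  have hratio : ∀ᵐ x ∂μ, L.Gamma ψ ψ x / (ψ x ^ 2 * Real.log (ψ x) ^ 2) =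
      L.Gamma Φ Φ x / Φ x ^ 2 := by
    filter_upwards [hcalc, hμU] with x hx hxU
    rw [(hx hxU).2, ← sq_abs (Real.log (ψ x)), habs,
      mul_div_mul_left _ _ (pow_ne_zero 2 (hψpos x hxU).ne')]
  -- A positive harmonic `Φ` makes the Hardy inequalities and the contraction hold unconditionally.
  have hardy : ∀ α : ℝ, α ≠ 1 → ∀ f : X → ℝ, L.MemA0 μ P W f →
      ∫ x, |Real.log (ψ x)| ^ α * (L.Gamma ψ ψ x / (ψ x ^ 2 * Real.log (ψ x) ^ 2)) * f x ^ 2 ∂μ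
        ≤ (2 / (α - 1)) ^ 2 * ∫ x, |Real.log (ψ x)| ^ α * L.Gamma f f x ∂μ := by
    intro α hα f hf
    have h := LogHardy.integral_hardy_le hμ hUo (fun x hx => hx.1) hsm hpos hharm hα hf.1
    simp_rw [habs]
    refine le_trans (le_of_eq (integral_congr_ae ?_)) h
    filter_upwards [hratio] with x hx
    rw [hx]
  have hardy0 : ∀ f : X → ℝ, L.MemA0 μ P W f →
      ∫ x, L.Gamma ψ ψ x / (ψ x ^ 2 * Real.log (ψ x) ^ 2) * f x ^ 2 ∂μ
        ≤ 4 * ∫ x, L.Gamma f f x ∂μ := by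
    intro f hf
    -- At `α = 0` the constant `(2 / (α - 1))²` is 4.
    have h := hardy 0 zero_ne_one f hf
    simp only [Real.rpow_zero, one_mul] at h
    norm_num at h
    exact h
  refine ⟨⟨fun _ => hardy0, fun _ f hf t ht => ?_⟩, fun α hα => ⟨fun _ => hardy α hα, fun _ => hardy0⟩⟩
  exact LogHardy.eLpNorm_weighted_semigroup_le hL hΦ0 hΦ_pos hW_eq hW hharm hμ hP hPL hf ht
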